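/- Let $M\ge 1$ and $\bar p=(p_1,\dots,p_M)$ with $p_i\in[\tfrac12,1)$, and assume that $\alpha(M,\bar p)=\sum_{i=1}^M(2p_i-1)-1>0$ (the transient regime). An $(M,\bar p)$-cookie random walk is a process $X=(X_n)_{n\ge 0}$ on $\mathbb Z$ with $X_0=0$ and $|X_{n+1}-X_n|=1$ almost surely such that, for all $n\ge 0$, $\mathbb P(X_{n+1}=X_n+1\mid X_0,\dots,X_n)=\omega(j)$, where $j=\#\{0\le i\le n: X_i=X_n\}$, $\omega(j)=p_j$ if $j\le M$ and $\omega(j)=\tfrac12$ if $j>M$. Let $(B_i)_{i\ge1}$ be independent Bernoulli variables with $\mathbb P(B_i=1)=\omega(i)$. For $j\ge 0$ let $k_j=\min\{k\ge 1:\#\{1\le i\le k: B_i=1\}=j+1\}$ and $A_j=\#\{1\le i\le k_j: B_i=0\}$. The associated Markov chain $Z=(Z_n)_{n\ge0}$ is the Markov chain on $\mathbb N=\{0,1,2,\dots\}$ with transition probabilities $\mathbb P(Z_{n+1}=k\mid Z_n=j)=\mathbb P(A_j=k)$. Then $Z_n$ converges in law, for every starting point $Z_0=z\in\mathbb N$,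 to a random variable $Z_\infty$ with values in $\mathbb N$ whose law does not depend on $z$ and is the unique invariant probability of $Z$. There is a real number $v=v(M,\bar p)$, the speed, such that for every $(M,\bar p)$-cookie random walk $X$ one has $X_n/n\to v$ almost surely, and $$v(M,\bar p)=\frac{1}{1+2\,\mathbb E[Z_\infty]}\qquad\Big(\text{with the convention }\tfrac1{+\infty}=0\Big).$$ In particular, $v(M,\bar p)\neq 0$ if and only if $\mathbb E[Z_\infty]<\infty$. -/

import Mathlib

open MeasureTheory ProbabilityTheory Filter Topology
open scoped ENNReal

/-- A deterministic, spatially uniform cookie environment with `M` cookies per site: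
`p i ∈ [1/2, 1)` is the strength of the `(i + 1)`-th cookie of each site, `i = 0, …, M - 1`. -/
structure CookieEnvironment (M : ℕ) where
  p : Fin M → ℝ
  half_le : ∀ i, 1 / 2 ≤ p i
  lt_one : ∀ i, p i < 1

namespace CookieEnvironment

variable {M : ℕ} (e : CookieEnvironment M)

/-- The parameter `α(M, p) = ∑ (2 p_i - 1) - 1`; the transient regime is `α > 0`. -/
noncomputable def alpha : ℝ := (∑ i, (2 * e.p i - 1)) - 1

/-- The probability of a jump to the right from a site that has been visited `i` times before the
present visit (so that the `(i + 1)`-th cookie is eaten, if there is one): `p_{i + 1}` if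
`i + 1 ≤ M`, and `1/2` otherwise. -/
noncomputable def strength (i : ℕ) : ℝ := if h : i < M then e.p ⟨i, h⟩ else 1 / 2

theorem strength_mem (i : ℕ) : e.strength i ∈ unitInterval := by
  unfold strength
  split_ifs with h
  · exact ⟨by linarith [e.half_le ⟨i, h⟩], (e.lt_one _).le⟩
  · norm_num

/-- `X` is an `(M, p)`-cookie random walk started at `z`, under the probability `μ`. The last field
says that, conditionally on the history `X_0 = x_0, …, X_n = x_n`, the walk jumps to `x_n + 1` with
probability `ω(j, x_n)`, where `j = #{0 ≤ i ≤ n : x_i = x_n}`; as `strength` is indexed from `0`,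
this is `strength (j - 1)`, with `j - 1 = #{0 ≤ i < n : x_i = x_n}`. -/
structure IsCookieWalk {Ω : Type*} [MeasurableSpace Ω] (z : ℤ) (X : ℕ → Ω → ℤ)
    (μ : Measure Ω) : Prop where
  measurable : ∀ n, Measurable (X n)
  start : ∀ᵐ ω ∂μ, X 0 ω = z
  nearest_neighbour : ∀ n, ∀ᵐ ω ∂μ, |X (n + 1) ω - X n ω| = 1
  step : ∀ (n : ℕ) (x : ℕ → ℤ),
    μ {ω | (∀ i ≤ n, X i ω = x i) ∧ X (n + 1) ω = x n + 1} =
      ENNReal.ofReal (e.strength ((Finset.range n).filter fun i => x i = x n).card) *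
        μ {ω | ∀ i ≤ n, X i ω = x i}

/-- The law of the sequence of independent Bernoulli variables `B_1, B_2, …`, where `B_i = 1` has
probability `p_i` if `i ≤ M` and `1/2` if `i > M`. Here `B_{i + 1}` is the coordinate of index `i`
on `ℕ → Bool`, with `true` for `1` and `false` for `0`. -/
noncomputable def coinLaw : Measure (ℕ → Bool) :=
  Measure.infinitePi fun i => bernoulliMeasure true false ⟨e.strength i, e.strength_mem i⟩

end CookieEnvironment

/-- `k_j = min {k ≥ 1 : #{1 ≤ i ≤ k : B_i = 1} = j + 1}`, the rank of the `(j + 1)`-th success. -/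
noncomputable def successTime (j : ℕ) (b : ℕ → Bool) : ℕ :=
  sInf {k | 1 ≤ k ∧ ((Finset.range k).filter fun i => b i = true).card = j + 1}

/-- `A_j = #{1 ≤ i ≤ k_j : B_i = 0}`, the number of failures before the `(j + 1)`-th success. -/
noncomputable def failures (j : ℕ) (b : ℕ → Bool) : ℕ :=
  ((Finset.range (successTime j b)).filter fun i => b i = false).card

namespace CookieEnvironment

variable {M : ℕ} (e : CookieEnvironment M)

/-- The transition probability `j → k` of the associated Markov chain, `P(A_j = k)`. -/
noncomputable def transition (j k : ℕ) : ℝ≥0∞ := e.coinLaw {b | failures j b = k}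

/-- `Z` is, under `μ`, a Markov chain on `ℕ` started at `z`, with transition probabilities
`P(Z_{n+1} = k | Z_n = j) = P(A_j = k)`. -/
structure IsAssociatedChain {Ω : Type*} [MeasurableSpace Ω] (z : ℕ) (Z : ℕ → Ω → ℕ)
    (μ : Measure Ω) : Prop where
  measurable : ∀ n, Measurable (Z n)
  start : ∀ᵐ ω ∂μ, Z 0 ω = z
  markov : ∀ (n : ℕ) (x : ℕ → ℕ) (k : ℕ),
    μ {ω | (∀ i ≤ n, Z i ω = x i) ∧ Z (n + 1) ω = k} =
      e.transition (x n) k * μ {ω | ∀ i ≤ n, Z i ω = x i}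

/-- `ν` is invariant for the transition probabilities of the associated Markov chain. -/
def IsInvariant (ν : Measure ℕ) : Prop :=
  ∀ k, ∑' j, ν {j} * e.transition j k = ν {k}

end CookieEnvironment

/-! Attach to every site `x` of `ℤ` an independent coin sequence `ξ x` and let the walk use the next
unused coin of its current site. Since no coin is used twice, this is a cookie random walk, and all
cookie walks started at `0` share its law (`isCookieWalk_walkPos`, `IsCookieWalk.map_eq`). So an
almost sure limit need only be proved for this walk.

The same coins drive the associated chain: `j ↦ failures j (ξ x)` is a random nondecreasing map
(`InfinitelyManyHeads.failures_mono`). Composing such maps backward from `0` gives a nondecreasing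
sequence of integers. For `j ≥ M` the mean of `A_j` is `j - α` (`lintegral_failures_add_alpha`), so
for `α > 0` the mass cannot escape to infinity (`alpha_mul_le`), and by a 0-1 law the backward
sequence is almost surely bounded, hence eventually constant (`ae_backwardBounded`). The law of its
limit is invariant; a coupling that uses independence of the sites (`tendsto_stackLaw_backward_ne`)
gives convergence from every start, and uniqueness follows.

For the speed, let `V x` be the backward limit along the sites `x, x + 1, …`; this is a stationary
profile with `V x = failures (V (x + 1)) (ξ x)`. Conservation of flow through the edges shows that
the walk never makes more than `V x` left jumps from `x` (`leftJumps_le`), and that, once at `m`, it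
has made at least as many from each `0 ≤ x < m` as the backward composition over `x, …, m - 1`
(`backward_le_leftJumps`). Time equals position plus twice the number of left jumps (`time_eq`). The
ergodic theorem for the shift of sites evaluates both bounds, so reaching `m` takes about `(1 + 2
E[Z_∞]) m` steps. On the left, a site with `V x = 0` is a barrier that the walk never crosses. If
the mean is infinite, the lower bound on time alone forces speed zero. -/

/-! ### Linear bounds for Birkhoff sums from the maximal ergodic inequality -/

section Birkhoff

variable {α : Type*}

/-- The running maximum `max (0, S_1 g, …, S_n g)` of the Birkhoff sums of `g`. -/
noncomputable def birkhoffMax (T : α → α) (g : α → ℝ) : ℕ → α → ℝ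
  | 0 => fun _ => 0
  | n + 1 => fun x => max 0 (g x + birkhoffMax T g n (T x))

theorem birkhoffMax_nonneg (T : α → α) (g : α → ℝ) (n : ℕ) (x : α) : 0 ≤ birkhoffMax T g n x := by
  cases n <;> simp [birkhoffMax]

theorem birkhoffMax_le_succ (T : α → α) (g : α → ℝ) (n : ℕ) (x : α) :
    birkhoffMax T g n x ≤ birkhoffMax T g (n + 1) x := by
  induction n generalizing x with
  | zero => exact birkhoffMax_nonneg _ _ _ _
  | succ n ih => exact max_le_max le_rfl (by linarith [ih (T x)])

theorem birkhoffSum_le_birkhoffMax (T : α → α) (g : α → ℝ) (n : ℕ) (x : α) :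
    birkhoffSum T g n x ≤ birkhoffMax T g n x := by
  induction n generalizing x with
  | zero => simp [birkhoffMax]
  | succ n ih =>
    rw [birkhoffSum_succ']
    exact le_max_of_le_right (by linarith [ih (T x)])

variable [MeasurableSpace α] {μ : Measure α} {T : α → α}

theorem measurable_birkhoffMax (hT : Measurable T) {g : α → ℝ} (hg : Measurable g) (n : ℕ) :
    Measurable (birkhoffMax T g n) := by
  induction n with
  | zero => exact measurable_const
  | succ n ih => exact measurable_const.max (hg.add (ih.comp hT))

theorem integrable_birkhoffMax (hT : MeasurePreserving T μ μ) {g : α → ℝ}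
    (hg : Integrable g μ) (n : ℕ) : Integrable (birkhoffMax T g n) μ := by
  induction n with
  | zero => exact integrable_zero _ _ _
  | succ n ih => exact (integrable_zero _ _ _).sup (hg.add (hT.integrable_comp_of_integrable ih))

/-- The maximal ergodic inequality. -/
theorem setIntegral_birkhoffMax_pos_nonneg (hT : MeasurePreserving T μ μ) {g : α → ℝ}
    (hgm : Measurable g) (hg : Integrable g μ) (n : ℕ) :
    0 ≤ ∫ x in {x | 0 < birkhoffMax T g n x}, g x ∂μ := by
  cases n with
  | zero => simp [birkhoffMax]
  | succ n =>
    set h := birkhoffMax T g (n + 1) with hh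
    have hint : Integrable h μ := integrable_birkhoffMax hT hg _
    have hm : Measurable h := measurable_birkhoffMax hT.measurable hgm _
    have hintT : Integrable (fun x => h (T x)) μ := hT.integrable_comp_of_integrable hint
    have hs : MeasurableSet {x | 0 < h x} := measurableSet_lt measurable_const hm
    have h0 : ∀ x, 0 ≤ h x := birkhoffMax_nonneg _ _ _
    -- Garsia's argument: `h` and `h ∘ T` have the same integral, and where `h > 0` the recursion
    -- gives `h ≤ g + h ∘ T`.
    calc (0 : ℝ) = ∫ x, h x ∂μ - ∫ x, h (T x) ∂μ := by
          rw [← hT.map_eq, integral_map hT.measurable.aemeasurable hm.aestronglyMeasurable,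
            hT.map_eq, sub_self]
      _ ≤ ∫ x in {x | 0 < h x}, h x ∂μ - ∫ x in {x | 0 < h x}, h (T x) ∂μ := by
          have e1 : ∫ x in {x | 0 < h x}, h x ∂μ = ∫ x, h x ∂μ :=
            setIntegral_eq_integral_of_forall_compl_eq_zero
              fun x hx => le_antisymm (not_lt.1 hx) (h0 x)
          have e2 : ∫ x in {x | 0 < h x}, h (T x) ∂μ ≤ ∫ x, h (T x) ∂μ :=
            setIntegral_le_integral hintT (Eventually.of_forall fun x => h0 _)
          linarith
      _ = ∫ x in {x | 0 < h x}, (h x - h (T x)) ∂μ :=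
          (integral_sub hint.integrableOn hintT.integrableOn).symm
      _ ≤ ∫ x in {x | 0 < h x}, g x ∂μ := by
          refine setIntegral_mono_on (hint.sub hintT).integrableOn hg.integrableOn hs fun x hx => ?_
          have hx' : 0 < max 0 (g x + birkhoffMax T g n (T x)) := hx
          have h1 : h x = max 0 (g x + birkhoffMax T g n (T x)) := rfl
          have h2 : max 0 (g x + birkhoffMax T g n (T x)) = g x + birkhoffMax T g n (T x) := by
            rcases lt_max_iff.1 hx' with h | h
            · exact absurd h (lt_irrefl _)
            · exact max_eq_right h.le
          have h3 := birkhoffMax_le_succ T g n (T x)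
          simp only [hh] at h1 ⊢
          linarith

/-- The sets in the maximal inequality increase to a set of full measure, so the inequality passes
to the limit. -/
theorem integral_nonneg_of_ae_exists_birkhoffSum_pos (hT : MeasurePreserving T μ μ) {g : α → ℝ}
    (hgm : Measurable g) (hg : Integrable g μ) (h : ∀ᵐ x ∂μ, ∃ n, 0 < birkhoffSum T g n x) :
    0 ≤ ∫ x, g x ∂μ := by
  have hmono : Monotone fun n => {x | 0 < birkhoffMax T g n x} :=
    monotone_nat_of_le_succ fun n x hx => lt_of_lt_of_le hx (birkhoffMax_le_succ _ _ _ _)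
  have hlim := tendsto_setIntegral_of_monotone
    (fun n => measurableSet_lt measurable_const (measurable_birkhoffMax hT.measurable hgm n))
    hmono (f := g) (μ := μ) hg.integrableOn
  have hfull : (⋃ n, {x | 0 < birkhoffMax T g n x}) =ᵐ[μ] Set.univ := by
    refine eventuallyEq_univ.2 ?_
    filter_upwards [h] with x ⟨n, hn⟩
    exact Set.mem_iUnion.2 ⟨n, hn.trans_le (birkhoffSum_le_birkhoffMax _ _ _ _)⟩
  rw [setIntegral_congr_set hfull, setIntegral_univ] at hlim
  exact ge_of_tendsto' hlim fun n => setIntegral_birkhoffMax_pos_nonneg hT hgm hg n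

theorem measurable_birkhoffSum (hT : Measurable T) {g : α → ℝ} (hg : Measurable g) (n : ℕ) :
    Measurable (birkhoffSum T g n) :=
  Finset.measurable_sum _ fun k _ => hg.comp (hT.iterate k)

/-- The upper half of the pointwise ergodic theorem: the Birkhoff sums of `f` are dominated by any
linear function whose slope exceeds the mean of `f`. -/
theorem Ergodic.ae_exists_birkhoffSum_le [IsProbabilityMeasure μ] (hT : Ergodic T μ) {f : α → ℝ}
    (hfm : Measurable f) (hf : Integrable f μ) {c : ℝ} (hc : ∫ x, f x ∂μ < c) :
    ∀ᵐ x ∂μ, ∃ K, ∀ n : ℕ, birkhoffSum T f n x ≤ c * n + K := by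
  set g : α → ℝ := fun x => f x - c with hg
  have hgm : Measurable g := hfm.sub measurable_const
  have hgi : Integrable g μ := hf.sub (integrable_const c)
  have hsum : ∀ n x, birkhoffSum T g n x = birkhoffSum T f n x - c * n := by
    intro n x
    simp [birkhoffSum, hg, Finset.sum_sub_distrib, mul_comm]
  -- The event that the centred sums are unbounded above is invariant, hence trivial. Full measure
  -- would force `∫ f ≥ c` by the previous lemma.
  set E : Set α := {x | ∀ K : ℕ, ∃ n, (K : ℝ) < birkhoffSum T g n x} with hE
  have hEm : MeasurableSet E := by
    have : E = ⋂ K : ℕ, ⋃ n, {x | (K : ℝ) < birkhoffSum T g n x} := by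
      ext x; simp [hE]
    rw [this]
    exact MeasurableSet.iInter fun K => MeasurableSet.iUnion fun n =>
      measurableSet_lt measurable_const (measurable_birkhoffSum hT.measurable hgm n)
  have hinv : T ⁻¹' E = E := by
    ext x
    constructor
    · intro hx K
      obtain ⟨K', hK'⟩ := exists_nat_gt (K - g x)
      obtain ⟨n, hn⟩ := hx K'
      exact ⟨n + 1, by rw [birkhoffSum_succ']; linarith⟩
    · intro hx K
      obtain ⟨K', hK'⟩ := exists_nat_gt (K + |g x|)
      obtain ⟨n, hn⟩ := hx K'
      rcases n with _ | n
      · simp only [birkhoffSum_zero] at hn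
        exact absurd hn (not_lt.2 (Nat.cast_nonneg K'))
      · rw [birkhoffSum_succ'] at hn
        exact ⟨n, by linarith [le_abs_self (g x)]⟩
  rcases hT.toPreErgodic.ae_mem_or_ae_notMem hEm hinv with h | h
  · have h0 := integral_nonneg_of_ae_exists_birkhoffSum_pos hT.toMeasurePreserving hgm hgi
      (h.mono fun x hx => by simpa using hx 0)
    have h1 : ∫ x, g x ∂μ = ∫ x, f x ∂μ - c := by
      rw [hg, integral_sub hf (integrable_const c)]; simp
    linarith
  · filter_upwards [h] with x hx
    simp only [hE, Set.mem_ofPred_eq, not_forall, not_exists, not_lt] at hx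
    obtain ⟨K, hK⟩ := hx
    exact ⟨K, fun n => by linarith [hK n, hsum n x]⟩

/-- The lower half of the pointwise ergodic theorem. -/
theorem Ergodic.ae_exists_le_birkhoffSum [IsProbabilityMeasure μ] (hT : Ergodic T μ) {f : α → ℝ}
    (hfm : Measurable f) (hf : Integrable f μ) {c : ℝ} (hc : c < ∫ x, f x ∂μ) :
    ∀ᵐ x ∂μ, ∃ K, ∀ n : ℕ, c * n - K ≤ birkhoffSum T f n x := by
  have h := hT.ae_exists_birkhoffSum_le (f := fun x => -f x) hfm.neg hf.neg (c := -c)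
    (by rw [integral_neg]; linarith)
  filter_upwards [h] with x ⟨K, hK⟩
  refine ⟨K, fun n => ?_⟩
  have h1 := hK n
  have h2 : birkhoffSum T (fun x => -f x) n x = -birkhoffSum T f n x := by
    simp [birkhoffSum]
  linarith

end Birkhoff

/-! ### Ergodicity of the shift of an i.i.d. sequence -/

section Shift

variable {S : Type*}

/-- The one-sided shift on sequences. -/
def seqShift (s : ℕ → S) : ℕ → S := fun k => s (k + 1)

theorem seqShift_iterate (n : ℕ) (s : ℕ → S) : seqShift^[n] s = fun k => s (k + n) := by
  induction n generalizing s with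
  | zero => rfl
  | succ n ih =>
    rw [Function.iterate_succ_apply, ih]
    funext k
    exact congrArg s (by omega)

variable [MeasurableSpace S]

theorem measurable_seqShift : Measurable (seqShift : (ℕ → S) → ℕ → S) :=
  measurable_pi_lambda _ fun k => measurable_pi_apply (k + 1)

/-- Sampling an i.i.d. family along an injective sequence of indices yields an i.i.d. family. -/
theorem measurePreserving_reindex_infinitePi {ι κ : Type*} (ν : Measure S)
    [IsProbabilityMeasure ν] {r : κ → ι} (hr : Function.Injective r) :
    MeasurePreserving (fun (s : ι → S) k => s (r k)) (Measure.infinitePi fun _ : ι => ν)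
      (Measure.infinitePi fun _ : κ => ν) := by
  exact ⟨measurable_pi_lambda _ fun k => measurable_pi_apply _,
    Measure.map_infinitePi_infinitePi_of_inj (P := fun _ : ι => ν) hr⟩

/-- The shift of an i.i.d. sequence is ergodic. -/
theorem ergodic_seqShift (ν : Measure S) [IsProbabilityMeasure ν] :
    Ergodic (seqShift : (ℕ → S) → ℕ → S) (Measure.infinitePi fun _ : ℕ => ν) where
  toMeasurePreserving := measurePreserving_reindex_infinitePi ν (add_left_injective 1)
  aeconst_set := by
    intro A hA hinv
    set P := Measure.infinitePi fun _ : ℕ => ν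
    have hle : ∀ n : ℕ, MeasurableSpace.comap (fun s : ℕ → S => s n) inferInstance ≤
        (MeasurableSpace.pi : MeasurableSpace (ℕ → S)) := fun n => (measurable_pi_apply n).comap_le
    have hind : iIndep (fun n => MeasurableSpace.comap (fun s : ℕ → S => s n) inferInstance) P :=
      iIndepFun_infinitePi (X := fun _ x => x) (fun _ => measurable_id)
    -- An invariant set is its own preimage under the `n`-th shift, so it depends only on the
    -- coordinates from `n` on, for every `n`. Kolmogorov's 0-1 law applies.
    have htail : MeasurableSet[limsup
        (fun n => MeasurableSpace.comap (fun s : ℕ → S => s n) inferInstance) atTop] A := by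
      rw [limsup_eq_iInf_iSup_of_nat, MeasurableSpace.measurableSet_iInf]
      intro n
      have hA' : (fun (s : ℕ → S) k => s (k + n)) ⁻¹' A = A := by
        have : seqShift^[n] ⁻¹' A = A := Function.IsFixedPt.preimage_iterate hinv n
        rwa [funext (seqShift_iterate n)] at this
      have hm : @Measurable _ _ (⨆ i ≥ n, MeasurableSpace.comap (fun s : ℕ → S => s i) inferInstance)
          _ (fun (s : ℕ → S) k => s (k + n)) := by
        refine @measurable_pi_lambda _ _ _ (_) _ _ fun k => ?_
        refine Measurable.mono (comap_measurable (fun s : ℕ → S => s (k + n))) ?_ le_rfl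
        exact le_iSup₂_of_le (k + n) (Nat.le_add_left _ _) le_rfl
      rw [← hA']
      exact hm hA
    rcases measure_zero_or_one_of_measurableSet_limsup_atTop hle hind htail with h | h
    · exact eventuallyConst_set'.2 (Or.inl (ae_eq_empty.2 h))
    · exact eventuallyConst_set'.2 (Or.inr (eventuallyEq_univ.2 ((prob_compl_eq_zero_iff hA).2 h)))

end Shift

/-! ### Counting successes and failures in one coin sequence -/

section CoinCounts

/-- The number of successes among the first `n` coins. -/
def heads (n : ℕ) (b : ℕ → Bool) : ℕ := ((Finset.range n).filter fun i => b i = true).card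

/-- The number of failures among the first `n` coins. -/
def tails (n : ℕ) (b : ℕ → Bool) : ℕ := ((Finset.range n).filter fun i => b i = false).card

/-- The coin sequence has infinitely many successes. -/
def InfinitelyManyHeads (b : ℕ → Bool) : Prop := ∀ j, ∃ n, j < heads n b

variable {b : ℕ → Bool} {n j : ℕ}

theorem heads_zero (b : ℕ → Bool) : heads 0 b = 0 := rfl

theorem tails_zero (b : ℕ → Bool) : tails 0 b = 0 := rfl

theorem heads_succ (n : ℕ) (b : ℕ → Bool) :
    heads (n + 1) b = heads n b + if b n = true then 1 else 0 := by
  unfold heads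
  rw [Finset.range_add_one, Finset.filter_insert]
  split_ifs <;> simp

theorem tails_succ (n : ℕ) (b : ℕ → Bool) :
    tails (n + 1) b = tails n b + if b n = true then 0 else 1 := by
  unfold tails
  rw [Finset.range_add_one, Finset.filter_insert]
  cases h : b n <;> simp

theorem heads_add_tails (n : ℕ) (b : ℕ → Bool) : heads n b + tails n b = n := by
  induction n with
  | zero => rfl
  | succ n ih => rw [heads_succ, tails_succ]; split_ifs <;> omega

theorem heads_le (n : ℕ) (b : ℕ → Bool) : heads n b ≤ n := by
  have := heads_add_tails n b; omega

theorem heads_mono (b : ℕ → Bool) : Monotone fun n => heads n b :=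
  monotone_nat_of_le_succ fun n => by simp only [heads_succ]; omega

theorem tails_mono (b : ℕ → Bool) : Monotone fun n => tails n b :=
  monotone_nat_of_le_succ fun n => by simp only [tails_succ]; omega

theorem exists_heads_eq (h : j ≤ heads n b) : ∃ m ≤ n, heads m b = j := by
  induction n with
  | zero => exact ⟨0, le_rfl, by rw [heads_zero] at *; omega⟩
  | succ n ih =>
    by_cases h' : j ≤ heads n b
    · obtain ⟨m, hm, e⟩ := ih h'
      exact ⟨m, by omega, e⟩
    · refine ⟨n + 1, le_rfl, ?_⟩
      rw [heads_succ] at h ⊢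
      split_ifs at h ⊢ <;> omega

theorem one_le_of_heads_eq_succ (h : heads n b = j + 1) : 1 ≤ n := by
  have := heads_le n b; omega

theorem successTime_le (h : j + 1 ≤ heads n b) : successTime j b ≤ n := by
  obtain ⟨m, hm, e⟩ := exists_heads_eq h
  have hmem : m ∈ {k | 1 ≤ k ∧ ((Finset.range k).filter fun i => b i = true).card = j + 1} :=
    ⟨one_le_of_heads_eq_succ e, e⟩
  exact (Nat.sInf_le hmem).trans hm

/-- Without enough successes the defining set is empty and `successTime` takes the default value
`0`; hence the hypothesis. -/
theorem InfinitelyManyHeads.heads_successTime (hb : InfinitelyManyHeads b) (j : ℕ) :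
    heads (successTime j b) b = j + 1 := by
  obtain ⟨n, hn⟩ := hb j
  obtain ⟨m, -, e⟩ := exists_heads_eq (Nat.succ_le_of_lt hn)
  have hne : {k | 1 ≤ k ∧ ((Finset.range k).filter fun i => b i = true).card = j + 1}.Nonempty :=
    ⟨m, one_le_of_heads_eq_succ e, e⟩
  exact (Nat.sInf_mem hne).2

theorem InfinitelyManyHeads.lt_successTime_iff (hb : InfinitelyManyHeads b) :
    n < successTime j b ↔ heads n b ≤ j := by
  constructor
  · intro h
    by_contra hc
    exact absurd (successTime_le (Nat.succ_le_of_lt (not_le.1 hc))) (not_le.2 h)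
  · intro h
    by_contra hc
    have := heads_mono b (not_lt.1 hc)
    simp only [hb.heads_successTime] at this
    omega

theorem failures_eq_tails (j : ℕ) (b : ℕ → Bool) : failures j b = tails (successTime j b) b := rfl

theorem InfinitelyManyHeads.failures_add (hb : InfinitelyManyHeads b) (j : ℕ) :
    failures j b + (j + 1) = successTime j b := by
  have := heads_add_tails (successTime j b) b
  rw [hb.heads_successTime] at this
  rw [failures_eq_tails]
  omega

/-- This bound and `failures_le_tails` later convert bounds on the right jumps from a site into
bounds on its left jumps. -/
theorem InfinitelyManyHeads.tails_le_failures (hb : InfinitelyManyHeads b) (h : heads n b ≤ j) :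
    tails n b ≤ failures j b :=
  tails_mono b (hb.lt_successTime_iff.2 h).le

theorem failures_le_tails (h : j + 1 ≤ heads n b) : failures j b ≤ tails n b :=
  tails_mono b (successTime_le h)

/-- Monotonicity in the state is what makes the backward compositions converge. -/
theorem InfinitelyManyHeads.failures_mono (hb : InfinitelyManyHeads b) :
    Monotone fun j => failures j b := by
  intro i j hij
  refine tails_mono b ?_
  exact successTime_le (by rw [hb.heads_successTime]; omega)

theorem measurable_heads (n : ℕ) : Measurable (heads n) := by
  induction n with
  | zero => exact measurable_const
  | succ n ih =>
    have : heads (n + 1) = fun b => heads n b + if b n = true then 1 else 0 :=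
      funext fun b => heads_succ n b
    rw [this]
    exact ih.add ((measurable_from_top (f := fun c : Bool => if c = true then 1 else 0)).comp
      (measurable_pi_apply n))

theorem measurable_tails (n : ℕ) : Measurable (tails n) := by
  have : tails n = fun b => n - heads n b := funext fun b => by
    have := heads_add_tails n b; omega
  rw [this]
  exact (measurable_from_top (f := fun k : ℕ => n - k)).comp (measurable_heads n)

theorem measurable_successTime (j : ℕ) : Measurable (successTime j) := by
  have hpos : ∀ n, MeasurableSet (successTime j ⁻¹' {n + 1}) := by
    intro n
    have : successTime j ⁻¹' {n + 1} =
        {b | heads n b ≤ j} ∩ {b | heads (n + 1) b = j + 1} := by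
      ext b
      simp only [Set.mem_preimage, Set.mem_singleton_iff, Set.mem_inter_iff, Set.mem_ofPred_eq]
      constructor
      · intro h
        have hne : {k | 1 ≤ k ∧ ((Finset.range k).filter fun i => b i = true).card = j + 1}.Nonempty :=
          Nat.nonempty_of_pos_sInf (by change 0 < successTime j b; omega)
        have h1 : heads (successTime j b) b = j + 1 := (Nat.sInf_mem hne).2
        rw [h] at h1
        refine ⟨?_, h1⟩
        by_contra hc
        have := successTime_le (Nat.succ_le_of_lt (not_le.1 hc))
        omega
      · rintro ⟨h1, h2⟩
        refine le_antisymm (successTime_le h2.ge) ?_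
        by_contra hc
        have hne : {k | 1 ≤ k ∧ ((Finset.range k).filter fun i => b i = true).card = j + 1}.Nonempty :=
          ⟨n + 1, by omega, h2⟩
        have h3 : heads (successTime j b) b = j + 1 := (Nat.sInf_mem hne).2
        have h4 := heads_mono b (show successTime j b ≤ n by omega)
        simp only at h4
        omega
    rw [this]
    exact (measurableSet_le (measurable_heads n) measurable_const).inter
      (measurableSet_eq_fun (measurable_heads _) measurable_const)
  refine measurable_to_countable' fun n => ?_
  rcases n with _ | n
  -- The value `0` is only the default of `sInf`, so it is handled as the complement of all positive
  -- values.
  · have : successTime j ⁻¹' {0} = (⋃ n, successTime j ⁻¹' {n + 1})ᶜ := by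
      ext b
      simp only [Set.mem_preimage, Set.mem_singleton_iff, Set.mem_compl_iff, Set.mem_iUnion]
      constructor
      · rintro h ⟨n, hn⟩; omega
      · intro h
        by_contra hc
        exact h ⟨successTime j b - 1, by omega⟩
    rw [this]
    exact (MeasurableSet.iUnion hpos).compl
  · exact hpos n

theorem measurable_failures (j : ℕ) : Measurable (failures j) :=
  (measurable_from_prod_countable_right (f := fun q : ℕ × (ℕ → Bool) => tails q.1 q.2)
    measurable_tails).comp ((measurable_successTime j).prodMk measurable_id)

theorem measurable_failures_uncurry : Measurable fun q : ℕ × (ℕ → Bool) => failures q.1 q.2 :=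
  measurable_from_prod_countable_right measurable_failures

/-- Of the first `n` coins, exactly `min (heads n) (j + 1)` are among the first `j + 1` successes. -/
theorem sum_indicator_heads_le (n j : ℕ) (b : ℕ → Bool) :
    ∑ i ∈ Finset.range n, {b | heads i b ≤ j ∧ b i = true}.indicator (1 : (ℕ → Bool) → ℝ≥0∞) b =
      (min (heads n b) (j + 1) : ℕ) := by
  induction n with
  | zero => simp [heads_zero]
  | succ n ih =>
    rw [Finset.sum_range_succ, ih, heads_succ]
    by_cases h1 : b n = true
    · by_cases h2 : heads n b ≤ j
      · rw [Set.indicator_of_mem (by exact ⟨h2, h1⟩), if_pos h1, Pi.one_apply,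
          min_eq_left (by omega), min_eq_left (by omega)]
        push_cast; rfl
      · rw [Set.indicator_of_notMem (by exact fun h => h2 h.1), if_pos h1,
          min_eq_right (by omega), min_eq_right (by omega), add_zero]
    · rw [Set.indicator_of_notMem (by exact fun h => h1 h.2), if_neg h1, add_zero, add_zero]

end CoinCounts

/-! ### Moments and positivity of the transition law -/

namespace CookieEnvironment

variable {M : ℕ} (e : CookieEnvironment M)

instance : IsProbabilityMeasure e.coinLaw := by unfold coinLaw; infer_instance

theorem half_le_strength (i : ℕ) : 1 / 2 ≤ e.strength i := by
  unfold strength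
  split_ifs
  · exact e.half_le _
  · exact le_rfl

theorem strength_lt_one (i : ℕ) : e.strength i < 1 := by
  unfold strength
  split_ifs
  · exact e.lt_one _
  · norm_num

/-- The probability that the coin of index `i` shows `c`. -/
noncomputable def coinProb (i : ℕ) (c : Bool) : ℝ≥0∞ :=
  ENNReal.ofReal (if c = true then e.strength i else 1 - e.strength i)

theorem bernoulliMeasure_singleton (i : ℕ) (c : Bool) :
    bernoulliMeasure true false ⟨e.strength i, e.strength_mem i⟩ {c} = e.coinProb i c := by
  cases c
  · rw [bernoulliMeasure_apply_of_notMem_of_mem _ (measurableSet_singleton _) (by simp) (by simp)]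
    simp only [coinProb, Bool.false_eq_true, if_false, ENNReal.ofReal]
    congr 1
    ext
    rw [Real.coe_toNNReal _ (by linarith [e.strength_lt_one i])]
    rfl
  · rw [bernoulliMeasure_apply_of_mem_of_notMem _ (measurableSet_singleton _) (by simp) (by simp)]
    simp only [coinProb, if_true, ENNReal.ofReal]
    congr 1
    ext
    rw [Real.coe_toNNReal _ (by linarith [e.half_le_strength i])]
    rfl

theorem coinProb_pos (i : ℕ) (c : Bool) : 0 < e.coinProb i c := by
  rw [coinProb, ENNReal.ofReal_pos]
  split_ifs
  · linarith [e.half_le_strength i]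
  · linarith [e.strength_lt_one i]

theorem half_le_coinProb_true (i : ℕ) : 2⁻¹ ≤ e.coinProb i true := by
  have : (2⁻¹ : ℝ≥0∞) = ENNReal.ofReal (1 / 2) := by
    rw [one_div, ENNReal.ofReal_inv_of_pos (by norm_num)]; simp
  rw [this, coinProb, if_pos rfl]
  exact ENNReal.ofReal_le_ofReal (e.half_le_strength i)

theorem coinLaw_cylinder (I : Finset ℕ) (c : ℕ → Bool) :
    e.coinLaw {b | ∀ i ∈ I, b i = c i} = ∏ i ∈ I, e.coinProb i (c i) := by
  have : {b : ℕ → Bool | ∀ i ∈ I, b i = c i} = Set.pi I fun i => {c i} := by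
    ext b; simp
  rw [this, coinLaw, Measure.infinitePi_pi _ fun i _ => measurableSet_singleton _]
  exact Finset.prod_congr rfl fun i _ => e.bernoulliMeasure_singleton i (c i)

theorem heads_congr {b b' : ℕ → Bool} {n : ℕ} (h : ∀ i < n, b i = b' i) : heads n b = heads n b' := by
  unfold heads
  congr 1
  refine Finset.filter_congr fun i hi => ?_
  rw [h i (Finset.mem_range.1 hi)]

/-- The count `heads n` involves only coins of index below `n`, so it is independent of the coin of
index `n`. -/
theorem coinLaw_heads_le_and_true (n j : ℕ) :
    e.coinLaw {b | heads n b ≤ j ∧ b n = true} =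
      e.coinLaw {b | heads n b ≤ j} * e.coinProb n true := by
  have hind : iIndepFun (fun (i : ℕ) (b : ℕ → Bool) => b i) e.coinLaw :=
    iIndepFun_infinitePi (X := fun _ x => x) (fun _ => measurable_id)
  have h := hind.indepFun_finset (Finset.range n) {n} (by simp) fun i => measurable_pi_apply i
  -- The event is rewritten through finitely many coordinates, where every set of configurations is
  -- measurable.
  have e1 : {b | heads n b ≤ j} = (fun (b : ℕ → Bool) (i : Finset.range n) => b i) ⁻¹'
      {f | ∀ b : ℕ → Bool, (∀ i : Finset.range n, b i = f i) → heads n b ≤ j} := by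
    ext b
    simp only [Set.mem_preimage, Set.mem_ofPred_eq]
    constructor
    · intro hb b' hb'
      rwa [heads_congr fun i hi => hb' ⟨i, Finset.mem_range.2 hi⟩]
    · intro hb
      exact hb b fun _ => rfl
  have e2 : {b : ℕ → Bool | b n = true} =
      (fun (b : ℕ → Bool) (i : ({n} : Finset ℕ)) => b i) ⁻¹'
      {f | f ⟨n, Finset.mem_singleton_self n⟩ = true} := rfl
  have h3 := h.measure_inter_preimage_eq_mul
    (s := {f | ∀ b : ℕ → Bool, (∀ i : Finset.range n, b i = f i) → heads n b ≤ j})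
    (t := {f | f ⟨n, Finset.mem_singleton_self n⟩ = true})
    (Set.toFinite _).measurableSet (Set.toFinite _).measurableSet
  rw [← e1, ← e2] at h3
  have h4 : e.coinLaw {b : ℕ → Bool | b n = true} = e.coinProb n true := by
    simpa using e.coinLaw_cylinder {n} fun _ => true
  rw [← h4, ← h3]
  rfl

theorem measurableSet_heads_le (n j : ℕ) : MeasurableSet {b | heads n b ≤ j} :=
  measurableSet_le (measurable_heads n) measurable_const

theorem measurableSet_heads_le_and_true (n j : ℕ) :
    MeasurableSet {b : ℕ → Bool | heads n b ≤ j ∧ b n = true} :=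
  (measurableSet_heads_le n j).inter
    (measurableSet_eq_fun (measurable_pi_apply n) measurable_const)

theorem sum_coinLaw_heads_le (n j : ℕ) :
    ∑ i ∈ Finset.range n, e.coinLaw {b | heads i b ≤ j} * e.coinProb i true =
      ∫⁻ b, (min (heads n b) (j + 1) : ℕ) ∂e.coinLaw := by
  simp_rw [← sum_indicator_heads_le, ← coinLaw_heads_le_and_true]
  rw [lintegral_finsetSum _ fun i _ =>
    (measurable_one.indicator (measurableSet_heads_le_and_true i j))]
  exact Finset.sum_congr rfl fun i _ =>
    (lintegral_indicator_one (measurableSet_heads_le_and_true i j)).symm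

/-- The sum is the mean number of tosses up to success `j + 1`. Each toss succeeds with probability
at least `1/2`, so it costs at most two per success. -/
theorem tsum_coinLaw_heads_le (j : ℕ) :
    ∑' i, e.coinLaw {b | heads i b ≤ j} ≤ 2 * (j + 1) := by
  rw [ENNReal.tsum_eq_iSup_nat]
  refine iSup_le fun n => ?_
  calc ∑ i ∈ Finset.range n, e.coinLaw {b | heads i b ≤ j}
      ≤ ∑ i ∈ Finset.range n, 2 * (e.coinLaw {b | heads i b ≤ j} * e.coinProb i true) := by
        refine Finset.sum_le_sum fun i _ => ?_
        calc e.coinLaw {b | heads i b ≤ j}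
            = 2 * (e.coinLaw {b | heads i b ≤ j} * 2⁻¹) := by
              rw [mul_comm, mul_assoc, ENNReal.inv_mul_cancel (by simp) (by simp), mul_one]
          _ ≤ _ := by gcongr; exact e.half_le_coinProb_true i
    _ = 2 * ∫⁻ b, (min (heads n b) (j + 1) : ℕ) ∂e.coinLaw := by
        rw [← Finset.mul_sum, sum_coinLaw_heads_le]
    _ ≤ 2 * ∫⁻ _, (j + 1 : ℕ) ∂e.coinLaw := by
        gcongr
        exact min_le_right _ _
    _ = 2 * (j + 1) := by simp

/-- The series just bounded has terms tending to `0`, and each term dominates the probability of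
never exceeding `j` successes. -/
theorem ae_infinitelyManyHeads : ∀ᵐ b ∂e.coinLaw, InfinitelyManyHeads b := by
  refine ae_all_iff.2 fun j => ?_
  have h0 : Tendsto (fun i => e.coinLaw {b | heads i b ≤ j}) atTop (𝓝 0) :=
    ENNReal.tendsto_atTop_zero_of_tsum_ne_top
      (ne_top_of_le_ne_top (by finiteness) (e.tsum_coinLaw_heads_le j))
  refine le_antisymm (ge_of_tendsto' h0 fun i => measure_mono fun b hb => ?_) zero_le
  simp only [Set.mem_compl_iff, Set.mem_ofPred_eq, not_exists, not_lt] at hb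
  exact hb i

theorem lintegral_successTime (j : ℕ) :
    ∫⁻ b, (successTime j b : ℝ≥0∞) ∂e.coinLaw = ∑' i, e.coinLaw {b | heads i b ≤ j} := by
  have h : ∀ᵐ b ∂e.coinLaw, (successTime j b : ℝ≥0∞) =
      ∑' i, {b | heads i b ≤ j}.indicator (1 : (ℕ → Bool) → ℝ≥0∞) b := by
    filter_upwards [e.ae_infinitelyManyHeads] with b hb
    have : ∀ i, {b | heads i b ≤ j}.indicator (1 : (ℕ → Bool) → ℝ≥0∞) b =
        if i ∈ Finset.range (successTime j b) then 1 else 0 := by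
      intro i
      simp only [Set.indicator_apply, Set.mem_ofPred_eq, Finset.mem_range, hb.lt_successTime_iff,
        Pi.one_apply]
    simp_rw [this]
    rw [tsum_eq_sum (s := Finset.range (successTime j b)) fun i hi => if_neg hi,
      Finset.sum_congr rfl fun i hi => if_pos hi]
    simp
  rw [lintegral_congr_ae h, lintegral_tsum fun i =>
    (measurable_one.indicator (measurableSet_heads_le i j)).aemeasurable]
  exact tsum_congr fun i => lintegral_indicator_one (measurableSet_heads_le i j)

theorem lintegral_failures_add_eq (j : ℕ) :
    ∫⁻ b, (failures j b : ℝ≥0∞) ∂e.coinLaw + (j + 1) =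
      ∑' i, e.coinLaw {b | heads i b ≤ j} := by
  rw [← lintegral_successTime]
  have : ((j : ℝ≥0∞) + 1) = ∫⁻ _, ((j : ℝ≥0∞) + 1) ∂e.coinLaw := by simp
  rw [this, ← lintegral_add_right _ measurable_const]
  refine lintegral_congr_ae ?_
  filter_upwards [e.ae_infinitelyManyHeads] with b hb
  rw [← hb.failures_add j]
  push_cast
  ring

theorem lintegral_failures_le (j : ℕ) : ∫⁻ b, (failures j b : ℝ≥0∞) ∂e.coinLaw ≤ j + 1 := by
  have h := (e.lintegral_failures_add_eq j).trans_le (e.tsum_coinLaw_heads_le j)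
  rw [two_mul] at h
  exact (ENNReal.add_le_add_iff_right (by finiteness)).1 h

/-- Wald's identity for the number of successes at the time of the `(j + 1)`-st success. -/
theorem tsum_coinLaw_heads_le_mul (j : ℕ) :
    ∑' i, e.coinLaw {b | heads i b ≤ j} * e.coinProb i true = j + 1 := by
  have hlim : Tendsto (fun n => ∫⁻ b, (min (heads n b) (j + 1) : ℕ) ∂e.coinLaw) atTop
      (𝓝 (∫⁻ _, ((j + 1 : ℕ) : ℝ≥0∞) ∂e.coinLaw)) := by
    refine lintegral_tendsto_of_tendsto_of_monotone (fun n => ?_) ?_ ?_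
    · exact ((measurable_from_top (f := fun k : ℕ => ((min k (j + 1) : ℕ) : ℝ≥0∞))).comp
        (measurable_heads n)).aemeasurable
    · refine Eventually.of_forall fun b m n hmn => ?_
      exact Nat.cast_le.2 (min_le_min_right _ (heads_mono b hmn))
    · filter_upwards [e.ae_infinitelyManyHeads] with b hb
      obtain ⟨n, hn⟩ := hb j
      refine tendsto_const_nhds.congr' ?_
      filter_upwards [eventually_ge_atTop n] with m hm
      have := heads_mono b hm
      simp only at this
      rw [min_eq_right (by omega)]
  have h2 := ENNReal.tendsto_nat_tsum fun i => e.coinLaw {b | heads i b ≤ j} * e.coinProb i true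
  simp_rw [sum_coinLaw_heads_le] at h2
  rw [tendsto_nhds_unique h2 hlim]
  simp

theorem coinProb_true_of_le {i : ℕ} (h : M ≤ i) : e.coinProb i true = 2⁻¹ := by
  rw [coinProb, if_pos rfl, strength, dif_neg (not_lt.2 h), one_div,
    ENNReal.ofReal_inv_of_pos (by norm_num)]
  simp

theorem sum_two_mul_strength_sub_one :
    ∑ i ∈ Finset.range M, (2 * e.strength i - 1) = e.alpha + 1 := by
  rw [alpha, Finset.sum_range]
  simp [strength]

/-- The drift of the associated chain away from the states `j < M` is `-α`. -/
theorem lintegral_failures_add_alpha (hα : 0 ≤ e.alpha) {j : ℕ} (hj : M ≤ j) :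
    ∫⁻ b, (failures j b : ℝ≥0∞) ∂e.coinLaw + ENNReal.ofReal e.alpha = j := by
  set u : ℕ → ℝ≥0∞ := fun i => e.coinLaw {b | heads i b ≤ j} with hu
  have hu1 : ∀ i < M, u i = 1 := by
    intro i hi
    have : {b | heads i b ≤ j} = Set.univ :=
      Set.eq_univ_of_forall fun b => by have := heads_le i b; change heads i b ≤ j; omega
    rw [hu]
    simp only [this, measure_univ]
  -- As `M ≤ j`, the first `M` coins are always tossed, and the later ones are fair. Hence the bias
  -- enters only through the deterministic sum `∑ (2 p_i - 1) = α + 1`.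
  have hkey : ∀ i, 2 * (u i * e.coinProb i true) =
      u i + if i ∈ Finset.range M then ENNReal.ofReal (2 * e.strength i - 1) else 0 := by
    intro i
    by_cases hi : i < M
    · rw [hu1 i hi, one_mul, if_pos (Finset.mem_range.2 hi), coinProb, if_pos rfl,
        ← ENNReal.ofReal_one, ← ENNReal.ofReal_add (by norm_num) (by linarith [e.half_le_strength i])]
      rw [show (2 : ℝ≥0∞) = ENNReal.ofReal 2 by simp, ← ENNReal.ofReal_mul (by norm_num)]
      congr 1; ring
    · rw [if_neg (by simpa using hi), e.coinProb_true_of_le (not_lt.1 hi), add_zero, mul_comm,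
        mul_assoc, ENNReal.inv_mul_cancel (by simp) (by simp), mul_one]
  have h1 : 2 * ((j : ℝ≥0∞) + 1) = ∑' i, u i + ENNReal.ofReal (e.alpha + 1) := by
    rw [← e.tsum_coinLaw_heads_le_mul j, ← ENNReal.tsum_mul_left, tsum_congr hkey,
      ENNReal.tsum_add, ← e.sum_two_mul_strength_sub_one,
      ENNReal.ofReal_sum_of_nonneg fun i _ => by linarith [e.half_le_strength i],
      tsum_eq_sum (s := Finset.range M) (f := fun i => if i ∈ Finset.range M then _ else _)
        fun i hi => if_neg hi]
    congr 1
    exact Finset.sum_congr rfl fun i hi => if_pos hi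
  rw [← e.lintegral_failures_add_eq j, ENNReal.ofReal_add hα (by norm_num), ENNReal.ofReal_one] at h1
  have h2 : (j : ℝ≥0∞) + (j + 1 + 1) =
      (∫⁻ b, (failures j b : ℝ≥0∞) ∂e.coinLaw + ENNReal.ofReal e.alpha) + (j + 1 + 1) := by
    rw [show (j : ℝ≥0∞) + (j + 1 + 1) = 2 * (j + 1) by ring, h1]
    ring
  exact ((ENNReal.add_left_inj (by finiteness)).1 h2).symm

/-- The coins may show `k` failures followed by `j + 1` successes, a finite pattern of positive
probability since all strengths lie strictly between `0` and `1`. -/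
theorem transition_pos (j k : ℕ) : 0 < e.transition j k := by
  set c : ℕ → Bool := fun i => decide (k ≤ i) with hc
  have hpos : 0 < e.coinLaw {b | ∀ i ∈ Finset.range (k + j + 1), b i = c i} := by
    rw [coinLaw_cylinder]
    exact CanonicallyOrderedAdd.prod_pos.2 fun i _ => e.coinProb_pos i _
  refine hpos.trans_le (measure_mono_ae ?_)
  filter_upwards [e.ae_infinitelyManyHeads] with b hb hbc
  have hcount : ∀ m ≤ k + j + 1, tails m b = min m k := by
    intro m
    induction m with
    | zero => simp [tails_zero]
    | succ m ih =>
      intro hm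
      have : b m = c m := hbc m (Finset.mem_range.2 (by omega))
      rw [tails_succ, ih (by omega), this]
      simp only [hc, decide_eq_true_eq]
      split_ifs <;> omega
  have h1 := hcount (k + j) (by omega)
  have h2 := hcount (k + j + 1) le_rfl
  have h3 := heads_add_tails (k + j) b
  have h4 := heads_add_tails (k + j + 1) b
  have h5 := hb.tails_le_failures (n := k + j) (j := j) (by omega)
  have h6 := failures_le_tails (n := k + j + 1) (j := j) (b := b) (by omega)
  change failures j b = k
  omega

end CookieEnvironment

/-! ### Independence of past and future, and tools for countable state spaces -/

section IidSequences

variable {S : Type*} [MeasurableSpace S]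

/-- For an i.i.d. sequence, an event that depends only on the first `n` terms is independent of the
sequence shifted by `n`. -/
theorem measure_inter_seqShift_preimage [Inhabited S] (ν : Measure S) [IsProbabilityMeasure ν]
    (n : ℕ) {A B : Set (ℕ → S)} (hA : MeasurableSet A)
    (hdep : ∀ s s' : ℕ → S, (∀ i < n, s i = s' i) → (s ∈ A ↔ s' ∈ A)) (hB : MeasurableSet B) :
    (Measure.infinitePi fun _ : ℕ => ν) (A ∩ seqShift^[n] ⁻¹' B) =
      (Measure.infinitePi fun _ : ℕ => ν) A * (Measure.infinitePi fun _ : ℕ => ν) B := by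
  set P := Measure.infinitePi fun _ : ℕ => ν
  set m : ℕ → MeasurableSpace (ℕ → S) :=
    fun n => MeasurableSpace.comap (fun s : ℕ → S => s n) inferInstance with hm
  have hle : ∀ n : ℕ, m n ≤ MeasurableSpace.pi := fun n => (measurable_pi_apply n).comap_le
  have hind : iIndep m P := iIndepFun_infinitePi (X := fun _ x => x) (fun _ => measurable_id)
  have hdisj : Disjoint {i : ℕ | i < n} {i : ℕ | n ≤ i} :=
    Set.disjoint_left.2 fun i hi hi' => by
      simp only [Set.mem_ofPred_eq] at hi hi'; omega
  have h := indep_iSup_of_disjoint hle hind hdisj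
  -- Erasing the coordinates from `n` on does not affect membership in `A`; this makes `A`
  -- measurable for the first `n` coordinates.
  set t : (ℕ → S) → ℕ → S := fun s i => if i < n then s i else default with ht
  have hA' : t ⁻¹' A = A := by
    ext s
    exact hdep _ _ fun i hi => if_pos hi
  have htm : @Measurable _ _ (⨆ i ∈ {i : ℕ | i < n}, m i) _ t := by
    refine @measurable_pi_lambda _ _ _ (_) _ _ fun k => ?_
    by_cases hk : k < n
    · simp only [ht, if_pos hk]
      exact Measurable.mono (comap_measurable (fun s : ℕ → S => s k))
        (le_iSup₂_of_le k hk le_rfl) le_rfl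
    · simp only [ht, if_neg hk]
      exact @measurable_const _ _ (_) (_) _
  have hsm : @Measurable _ _ (⨆ i ∈ {i : ℕ | n ≤ i}, m i) _ (seqShift^[n] : (ℕ → S) → ℕ → S) := by
    rw [funext (seqShift_iterate (S := S) n)]
    refine @measurable_pi_lambda _ _ _ (_) _ _ fun k => ?_
    exact Measurable.mono (comap_measurable (fun s : ℕ → S => s (k + n)))
      (le_iSup₂_of_le (k + n) (Nat.le_add_left n k) le_rfl) le_rfl
  have hprod := (Indep_iff _ _ P).1 h A (seqShift^[n] ⁻¹' B) (hA' ▸ htm hA) (hsm hB)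
  rw [hprod, ((ergodic_seqShift ν).toMeasurePreserving.iterate n).measure_preimage
    hB.nullMeasurableSet]

end IidSequences

section Countable

variable {Ω β : Type*} [MeasurableSpace Ω] [MeasurableSpace β] [Countable β]
  [MeasurableSingletonClass β] {μ : Measure Ω} {X : Ω → β}

theorem lintegral_comp_eq_tsum (hX : Measurable X) (f : β → ℝ≥0∞) :
    ∫⁻ ω, f (X ω) ∂μ = ∑' b, f b * μ {ω | X ω = b} := by
  have hf : Measurable f := fun s _ => (Set.to_countable _).measurableSet
  rw [← lintegral_map hf hX, lintegral_countable']
  refine tsum_congr fun b => ?_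
  rw [Measure.map_apply hX (measurableSet_singleton b)]
  rfl

theorem measure_eq_tsum_fiber (hX : Measurable X) (A : Set Ω) :
    μ A = ∑' b, μ ({ω | X ω = b} ∩ A) := by
  have h := lintegral_comp_eq_tsum (μ := μ.restrict A) hX fun _ => 1
  simp only [lintegral_one, Measure.restrict_apply_univ, one_mul] at h
  rw [h]
  refine tsum_congr fun b => Measure.restrict_apply ?_
  exact hX (measurableSet_singleton b)

/-- On `ℕ`, convergence of the masses of points to those of a probability measure is weak
convergence. -/
theorem tendsto_probabilityMeasure_nat {P : ℕ → ProbabilityMeasure ℕ} {Q : ProbabilityMeasure ℕ}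
    (h : ∀ k, Tendsto (fun n => (P n : Measure ℕ) {k}) atTop (𝓝 ((Q : Measure ℕ) {k}))) :
    Tendsto P atTop (𝓝 Q) := by
  refine tendsto_of_forall_isOpen_le_liminf' fun G _ => ?_
  have hG : ∀ ρ : Measure ℕ, ρ G = ∫⁻ k, G.indicator (fun k => ρ {k}) k ∂Measure.count := by
    intro ρ
    rw [lintegral_count, ← Measure.tsum_indicator_apply_singleton ρ G (Set.to_countable _).measurableSet]
  simp only [hG]
  -- Fatou's lemma for counting measure yields the portmanteau bound on open sets.
  calc ∫⁻ k, G.indicator (fun k => (Q : Measure ℕ) {k}) k ∂Measure.count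
      = ∫⁻ k, liminf (fun n => G.indicator (fun k => (P n : Measure ℕ) {k}) k) atTop
          ∂Measure.count := by
        refine lintegral_congr fun k => ?_
        by_cases hk : k ∈ G
        · simp only [Set.indicator_of_mem hk]
          exact (h k).liminf_eq.symm
        · simp only [Set.indicator_of_notMem hk]
          exact (tendsto_const_nhds (x := (0 : ℝ≥0∞))).liminf_eq.symm
    _ ≤ _ := lintegral_liminf_le fun n => measurable_from_top

end Countable

/-! ### Backward compositions of the random maps -/

section Backward

/-- The backward composition `φ_0 ∘ φ_1 ∘ ⋯ ∘ φ_{n-1}` evaluated at `z`, where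
`φ_i j = failures j (s i)`. -/
noncomputable def backward (z : ℕ) : ℕ → (ℕ → ℕ → Bool) → ℕ
  | 0, _ => z
  | n + 1, s => failures (backward z n (seqShift s)) (s 0)

/-- All the coin sequences have infinitely many successes. -/
def GoodStacks (s : ℕ → ℕ → Bool) : Prop := ∀ k, InfinitelyManyHeads (s k)

variable {s : ℕ → ℕ → Bool}

theorem GoodStacks.shift (hs : GoodStacks s) : GoodStacks (seqShift s) := fun k => hs (k + 1)

theorem backward_congr (z n : ℕ) {s s' : ℕ → ℕ → Bool} (h : ∀ i < n, s i = s' i) :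
    backward z n s = backward z n s' := by
  induction n generalizing s s' with
  | zero => rfl
  | succ n ih =>
    have h1 : backward z n (seqShift s) = backward z n (seqShift s') :=
      ih fun i hi => h (i + 1) (Nat.succ_lt_succ hi)
    simp only [backward]
    rw [h 0 (Nat.succ_pos n), h1]

/-- One more innermost map replaces the starting value `0` by something at least `0`, and the outer
maps are nondecreasing. -/
theorem backward_zero_le_succ (hs : GoodStacks s) (n : ℕ) :
    backward 0 n s ≤ backward 0 (n + 1) s := by
  induction n generalizing s with
  | zero => exact Nat.zero_le _
  | succ n ih => exact (hs 0).failures_mono (ih hs.shift)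

theorem backward_zero_monotone (hs : GoodStacks s) : Monotone fun n => backward 0 n s :=
  monotone_nat_of_le_succ (backward_zero_le_succ hs)

theorem measurable_backward (z n : ℕ) : Measurable (backward z n) := by
  induction n with
  | zero => exact measurable_const
  | succ n ih =>
    have h : Measurable fun s : ℕ → ℕ → Bool => (backward z n (seqShift s), s 0) :=
      (ih.comp measurable_seqShift).prodMk (measurable_pi_apply 0)
    have heq : backward z (n + 1) = (fun q : ℕ × (ℕ → Bool) => failures q.1 q.2) ∘
        fun s => (backward z n (seqShift s), s 0) := funext fun s => by
      simp only [backward, Function.comp_apply]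
    rw [heq]
    exact measurable_failures_uncurry.comp h

/-- The backward compositions started from `0` stay bounded. -/
def BackwardBounded (s : ℕ → ℕ → Bool) : Prop := ∃ K, ∀ n, backward 0 n s ≤ K

/-- The limit of the backward compositions started from `0`. -/
noncomputable def backwardLimit (s : ℕ → ℕ → Bool) : ℕ := ⨆ n, backward 0 n s

theorem measurable_backwardLimit : Measurable backwardLimit :=
  Measurable.iSup fun n => measurable_backward 0 n

theorem BackwardBounded.le_limit (h : BackwardBounded s) (n : ℕ) :
    backward 0 n s ≤ backwardLimit s :=
  le_ciSup (f := fun n => backward 0 n s) (h.imp fun _ hK => by rintro _ ⟨n, rfl⟩; exact hK n) n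

/-- A bounded nondecreasing sequence of integers attains its supremum and stays there. -/
theorem BackwardBounded.eventually_eq (h : BackwardBounded s) (hs : GoodStacks s) :
    ∀ᶠ n in atTop, backward 0 n s = backwardLimit s := by
  have hmem : backwardLimit s ∈ Set.range fun n => backward 0 n s :=
    Nat.sSup_mem (Set.range_nonempty _) (h.imp fun _ hK => by rintro _ ⟨n, rfl⟩; exact hK n)
  obtain ⟨N, hN⟩ := hmem
  filter_upwards [eventually_ge_atTop N] with n hn
  exact le_antisymm (h.le_limit n) (hN ▸ backward_zero_monotone hs hn)

/-- This inclusion is the almost invariance needed to apply ergodicity to boundedness. -/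
theorem BackwardBounded.of_shift (h : BackwardBounded (seqShift s)) (hs : GoodStacks s) :
    BackwardBounded s := by
  obtain ⟨K, hK⟩ := h
  refine ⟨failures K (s 0), fun n => ?_⟩
  exact (backward_zero_le_succ hs n).trans ((hs 0).failures_mono (hK n))

theorem backwardLimit_eq (hs : GoodStacks s) (h : BackwardBounded s)
    (h' : BackwardBounded (seqShift s)) :
    backwardLimit s = failures (backwardLimit (seqShift s)) (s 0) := by
  have h1 := (tendsto_add_atTop_nat 1).eventually (h.eventually_eq hs)
  obtain ⟨n, e1, e2⟩ := (h1.and (h'.eventually_eq hs.shift)).exists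
  rw [← e1, ← e2]
  rfl

theorem backwardLimit_eq_backward (n : ℕ) (hs : GoodStacks s)
    (h : ∀ n, BackwardBounded (seqShift^[n] s)) :
    backwardLimit s = backward (backwardLimit (seqShift^[n] s)) n s := by
  induction n generalizing s with
  | zero => rfl
  | succ n ih =>
    rw [backwardLimit_eq hs (h 0) (h 1), ih hs.shift fun n => h (n + 1)]
    rfl

theorem measurableSet_backwardBounded : MeasurableSet {s | BackwardBounded s} := by
  simp only [BackwardBounded, Set.ofPred_forall, Set.ofPred_exists]
  exact MeasurableSet.iUnion fun K => MeasurableSet.iInter fun n =>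
    measurableSet_le (measurable_backward 0 n) measurable_const

end Backward

/-! ### The limit law: invariance, uniqueness and convergence of the chain -/

namespace CookieEnvironment

variable {M : ℕ} (e : CookieEnvironment M)

/-- The law of an i.i.d. sequence of coin sequences. -/
noncomputable def stackLaw : Measure (ℕ → ℕ → Bool) := Measure.infinitePi fun _ => e.coinLaw

instance : IsProbabilityMeasure e.stackLaw := by unfold stackLaw; infer_instance

theorem ergodic_stackLaw : Ergodic seqShift e.stackLaw := ergodic_seqShift e.coinLaw

theorem ae_goodStacks : ∀ᵐ s ∂e.stackLaw, GoodStacks s :=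
  ae_all_iff.2 fun k =>
    (measurePreserving_eval_infinitePi (fun _ : ℕ => e.coinLaw) k).quasiMeasurePreserving.ae
      e.ae_infinitelyManyHeads

/-- Applying an independent step of the chain to a random state. -/
theorem stackLaw_failures_comp {G : (ℕ → ℕ → Bool) → ℕ} (hG : Measurable G) (k : ℕ) :
    e.stackLaw {s | failures (G (seqShift s)) (s 0) = k} =
      ∑' j, e.stackLaw {s | G s = j} * e.transition j k := by
  rw [measure_eq_tsum_fiber (hG.comp measurable_seqShift)]
  refine tsum_congr fun j => ?_
  have hA : MeasurableSet {s : ℕ → ℕ → Bool | failures j (s 0) = k} :=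
    measurableSet_eq_fun ((measurable_failures j).comp (measurable_pi_apply 0)) measurable_const
  have hB : MeasurableSet {s | G s = j} := hG (measurableSet_singleton j)
  have h := measure_inter_seqShift_preimage e.coinLaw 1 hA
    (fun s s' hs => by simp only [Set.mem_ofPred_eq, hs 0 one_pos]) hB
  have h1 : e.stackLaw {s | failures j (s 0) = k} = e.transition j k := by
    have := (measurePreserving_eval_infinitePi (fun _ : ℕ => e.coinLaw) 0).measure_preimage
      ((measurable_failures j) (measurableSet_singleton k)).nullMeasurableSet
    exact this
  rw [mul_comm, ← h1]
  refine Eq.trans (congrArg _ ?_) h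
  ext s
  simp only [Set.mem_inter_iff, Set.mem_ofPred_eq, Set.mem_preimage, Function.comp_apply,
    Function.iterate_one]
  constructor
  · rintro ⟨h1, h2⟩; exact ⟨h1 ▸ h2, h1⟩
  · rintro ⟨h1, h2⟩; exact ⟨h2, h2 ▸ h1⟩

/-- The probability that the chain started at `z` is at `k` after `n` steps. -/
noncomputable def stepProb (n z k : ℕ) : ℝ≥0∞ := e.stackLaw {s | backward z n s = k}

theorem stepProb_zero (z k : ℕ) : e.stepProb 0 z k = if z = k then 1 else 0 := by
  unfold stepProb backward
  split_ifs with h <;> simp [h]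

/-- The outermost map, driven by `s 0`, is independent of the rest and plays the role of the last
step, so the backward compositions have the one-time laws of the chain. -/
theorem stepProb_succ (n z k : ℕ) :
    e.stepProb (n + 1) z k = ∑' j, e.stepProb n z j * e.transition j k :=
  e.stackLaw_failures_comp (measurable_backward z n) k

theorem lintegral_coinLaw_failures (j : ℕ) (f : ℕ → ℝ≥0∞) :
    ∫⁻ b, f (failures j b) ∂e.coinLaw = ∑' k, f k * e.transition j k :=
  lintegral_comp_eq_tsum (measurable_failures j) f

theorem lintegral_backward_succ (n z : ℕ) (f : ℕ → ℝ≥0∞) :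
    ∫⁻ s, f (backward z (n + 1) s) ∂e.stackLaw =
      ∫⁻ s, ∫⁻ b, f (failures (backward z n s) b) ∂e.coinLaw ∂e.stackLaw := by
  rw [lintegral_comp_eq_tsum (measurable_backward z (n + 1)),
    lintegral_comp_eq_tsum (measurable_backward z n)
      (fun j => ∫⁻ b, f (failures j b) ∂e.coinLaw)]
  simp_rw [lintegral_coinLaw_failures, ← ENNReal.tsum_mul_right]
  rw [ENNReal.tsum_comm]
  refine tsum_congr fun k => ?_
  have := e.stepProb_succ n z k
  unfold stepProb at this
  rw [this, ← ENNReal.tsum_mul_left]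
  exact tsum_congr fun j => by ring

theorem lintegral_backward_le (n : ℕ) :
    ∫⁻ s, (backward 0 n s : ℝ≥0∞) ∂e.stackLaw ≤ n := by
  induction n with
  | zero => simp [backward]
  | succ n ih =>
    rw [e.lintegral_backward_succ n 0 fun k => (k : ℝ≥0∞)]
    calc _ ≤ ∫⁻ s, ((backward 0 n s : ℝ≥0∞) + 1) ∂e.stackLaw :=
          lintegral_mono fun s => e.lintegral_failures_le _
      _ = ∫⁻ s, (backward 0 n s : ℝ≥0∞) ∂e.stackLaw + 1 := by
          rw [lintegral_add_right _ measurable_const]; simp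
      _ ≤ _ := by push_cast; gcongr

/-- The drift condition keeps a positive fraction of the mass below `M`. -/
theorem alpha_mul_le (hα : 0 ≤ e.alpha) (n : ℕ) :
    ENNReal.ofReal e.alpha * e.stackLaw {s | M ≤ backward 0 n s} ≤
      e.stackLaw {s | backward 0 n s < M} := by
  set w := backward 0 n
  have hw : Measurable w := measurable_backward 0 n
  have hge : MeasurableSet {s | M ≤ w s} := measurableSet_le measurable_const hw
  have hlt : MeasurableSet {s | w s < M} := measurableSet_lt hw measurable_const
  set m : ℝ≥0∞ := ∫⁻ s, (w s : ℝ≥0∞) ∂e.stackLaw with hm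
  have hfin : m ≠ ∞ := ne_top_of_le_ne_top (ENNReal.natCast_ne_top n) (e.lintegral_backward_le n)
  have hinc : m ≤ ∫⁻ s, (backward 0 (n + 1) s : ℝ≥0∞) ∂e.stackLaw :=
    lintegral_mono_ae (e.ae_goodStacks.mono fun s hs =>
      Nat.cast_le.2 (backward_zero_le_succ hs n))
  -- The drift is `-α` from `M` on and at most `1` below. Averaging over `w`, whose mean `m` does
  -- not decrease in one step, leaves the claim after cancelling the finite `m`.
  have hpt : ∀ j : ℕ, ∫⁻ b, (failures j b : ℝ≥0∞) ∂e.coinLaw +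
      (if M ≤ j then ENNReal.ofReal e.alpha else 0) ≤ j + if j < M then 1 else 0 := by
    intro j
    by_cases hj : M ≤ j
    · rw [if_pos hj, if_neg (not_lt.2 hj), add_zero, e.lintegral_failures_add_alpha hα hj]
    · rw [if_neg hj, if_pos (not_le.1 hj), add_zero]
      exact e.lintegral_failures_le j
  have hcomp : ∀ f : ℕ → ℝ≥0∞, Measurable fun s => f (w s) := fun f =>
    (measurable_from_top (f := f)).comp hw
  have e1 : ∫⁻ s, (if M ≤ w s then ENNReal.ofReal e.alpha else 0) ∂e.stackLaw =
      ENNReal.ofReal e.alpha * e.stackLaw {s | M ≤ w s} := by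
    rw [← lintegral_indicator_const hge]
    simp only [Set.indicator_apply, Set.mem_ofPred_eq]
  have e2 : ∫⁻ s, (if w s < M then 1 else 0) ∂e.stackLaw = e.stackLaw {s | w s < M} := by
    rw [← lintegral_indicator_one hlt]
    simp only [Set.indicator_apply, Set.mem_ofPred_eq, Pi.one_apply]
  have hsum := lintegral_mono (μ := e.stackLaw) fun s => hpt (w s)
  rw [lintegral_add_left (hcomp fun j => ∫⁻ b, (failures j b : ℝ≥0∞) ∂e.coinLaw),
    lintegral_add_left (hcomp fun j => (j : ℝ≥0∞)), e1, e2,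
    ← e.lintegral_backward_succ n 0 fun k => (k : ℝ≥0∞)] at hsum
  exact (ENNReal.add_le_add_iff_left hfin).1 ((add_le_add_left hinc _).trans hsum)

/-- By ergodicity boundedness has probability `0` or `1`. If it had probability `0`, monotonicity
would send `backward 0 n` to infinity, so the mass below `M` would vanish, against `alpha_mul_le`.
-/
theorem ae_backwardBounded (hα : 0 < e.alpha) : ∀ᵐ s ∂e.stackLaw, BackwardBounded s := by
  have hinv : (seqShift ⁻¹' {s | BackwardBounded s} : Set (ℕ → ℕ → Bool)) ≤ᵐ[e.stackLaw]
      {s | BackwardBounded s} := by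
    filter_upwards [e.ae_goodStacks] with s hs h
    exact BackwardBounded.of_shift h hs
  rcases e.ergodic_stackLaw.ae_empty_or_univ_of_preimage_ae_le
    measurableSet_backwardBounded.nullMeasurableSet hinv with h | h
  · exfalso
    have hunb : ∀ᵐ s ∂e.stackLaw, ¬ BackwardBounded s := by
      filter_upwards [h] with s hs hb
      exact (show False from cast hs hb)
    have hlim : Tendsto (fun n => e.stackLaw {s | backward 0 n s < M}) atTop
        (𝓝 (e.stackLaw ∅)) := by
      refine tendsto_measure_of_ae_tendsto_indicator_of_isFiniteMeasure _ MeasurableSet.empty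
        (fun n => measurableSet_lt (measurable_backward 0 n) measurable_const) ?_
      filter_upwards [hunb, e.ae_goodStacks] with s hs hg
      simp only [BackwardBounded, not_exists, not_forall, not_le] at hs
      obtain ⟨N, hN⟩ := hs M
      filter_upwards [eventually_ge_atTop N] with n hn
      have := backward_zero_monotone hg hn
      simp only [Set.mem_empty_iff_false, iff_false, not_lt]
      exact hN.le.trans this
    rw [measure_empty] at hlim
    have hle : ∀ n, ENNReal.ofReal e.alpha ≤
        (1 + ENNReal.ofReal e.alpha) * e.stackLaw {s | backward 0 n s < M} := by
      intro n
      have h1 : e.stackLaw {s | M ≤ backward 0 n s} + e.stackLaw {s | backward 0 n s < M} = 1 := by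
        rw [← prob_add_prob_compl (μ := e.stackLaw)
          (measurableSet_le measurable_const (measurable_backward 0 n) :
            MeasurableSet {s | M ≤ backward 0 n s})]
        congr 2
        ext s; simp
      calc ENNReal.ofReal e.alpha
          = ENNReal.ofReal e.alpha * (e.stackLaw {s | M ≤ backward 0 n s} +
              e.stackLaw {s | backward 0 n s < M}) := by rw [h1, mul_one]
        _ ≤ e.stackLaw {s | backward 0 n s < M} +
              ENNReal.ofReal e.alpha * e.stackLaw {s | backward 0 n s < M} := by
            rw [mul_add]; gcongr; exact e.alpha_mul_le hα.le n
        _ = _ := by ring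
    have h2 := ENNReal.Tendsto.const_mul (a := 1 + ENNReal.ofReal e.alpha) hlim
      (Or.inr (by finiteness))
    rw [mul_zero] at h2
    have h3 := ge_of_tendsto' h2 hle
    exact absurd (ENNReal.ofReal_pos.2 hα) (not_lt.2 h3)
  · exact eventuallyEq_univ.1 h

theorem ae_backwardBounded_shift (hα : 0 < e.alpha) :
    ∀ᵐ s ∂e.stackLaw, ∀ n, BackwardBounded (seqShift^[n] s) :=
  ae_all_iff.2 fun n => (e.ergodic_stackLaw.toMeasurePreserving.iterate
    n).quasiMeasurePreserving.ae (e.ae_backwardBounded hα)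

/-- The law of the backward limit. -/
noncomputable def limitLaw : Measure ℕ := e.stackLaw.map backwardLimit

instance : IsProbabilityMeasure e.limitLaw :=
  Measure.isProbabilityMeasure_map measurable_backwardLimit.aemeasurable

theorem limitLaw_singleton (k : ℕ) : e.limitLaw {k} = e.stackLaw {s | backwardLimit s = k} :=
  Measure.map_apply measurable_backwardLimit (measurableSet_singleton k)

theorem isInvariant_limitLaw (hα : 0 < e.alpha) : e.IsInvariant e.limitLaw := by
  intro k
  simp_rw [limitLaw_singleton]
  rw [← e.stackLaw_failures_comp measurable_backwardLimit]
  refine measure_congr ?_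
  filter_upwards [e.ae_goodStacks, e.ae_backwardBounded_shift hα] with s hs hb
  have := backwardLimit_eq hs (hb 0) (hb 1)
  exact congrArg (· = k) this.symm

theorem limitLaw_singleton_pos (hα : 0 < e.alpha) (k : ℕ) : 0 < e.limitLaw {k} := by
  rw [← e.isInvariant_limitLaw hα k]
  have hne : ∃ j, e.limitLaw {j} ≠ 0 := by
    by_contra! h
    have h1 := measure_iUnion_null (μ := e.limitLaw) h
    rw [Set.iUnion_of_singleton, measure_univ] at h1
    exact one_ne_zero h1
  obtain ⟨j, hj⟩ := hne
  exact (ENNReal.mul_pos hj (e.transition_pos j k).ne').trans_le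
    (ENNReal.le_tsum (f := fun j => e.limitLaw {j} * e.transition j k) j)

/-- The chains started from `0` and from `z`, driven by the same coins, eventually coincide. -/
theorem tendsto_stackLaw_backward_ne (hα : 0 < e.alpha) (z : ℕ) :
    Tendsto (fun n => e.stackLaw {s | backward z n s ≠ backward 0 n s}) atTop (𝓝 0) := by
  have hmeas : ∀ n, MeasurableSet {s | backward z n s ≠ backward 0 n s} := fun n =>
    (measurableSet_eq_fun (measurable_backward z n) (measurable_backward 0 n)).compl
  have hlim : Tendsto (fun n => e.stackLaw {s | backward 0 n s ≠ backwardLimit s}) atTop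
      (𝓝 (e.stackLaw ∅)) := by
    refine tendsto_measure_of_ae_tendsto_indicator_of_isFiniteMeasure _ MeasurableSet.empty
      (fun n => (measurableSet_eq_fun (measurable_backward 0 n) measurable_backwardLimit).compl) ?_
    filter_upwards [e.ae_goodStacks, e.ae_backwardBounded hα] with s hs hb
    filter_upwards [hb.eventually_eq hs] with n hn
    simp [hn]
  rw [measure_empty] at hlim
  -- The limit seen from index `n` is independent of the first `n` maps and equals `z` with positive
  -- probability. On that event `backward z n` is already the limit, so a disagreement with
  -- `backward 0 n` means that the latter has not yet reached it.
  have hle : ∀ n, e.stackLaw {s | backward z n s ≠ backward 0 n s} ≤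
      (e.limitLaw {z})⁻¹ * e.stackLaw {s | backward 0 n s ≠ backwardLimit s} := by
    intro n
    have h := measure_inter_seqShift_preimage e.coinLaw n (hmeas n)
      (fun s s' hs => by
        simp only [Set.mem_ofPred_eq, backward_congr _ n hs])
      (measurable_backwardLimit (measurableSet_singleton z))
    have h1 : e.stackLaw {s | backward z n s ≠ backward 0 n s} * e.limitLaw {z} ≤
        e.stackLaw {s | backward 0 n s ≠ backwardLimit s} := by
      rw [limitLaw_singleton]
      refine h.symm.trans_le (measure_mono_ae ?_)
      filter_upwards [e.ae_goodStacks, e.ae_backwardBounded_shift hα] with s hs hb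
      rintro ⟨h1, h2⟩
      have h3 := backwardLimit_eq_backward n hs hb
      rw [show backwardLimit (seqShift^[n] s) = z from h2] at h3
      change backward 0 n s ≠ backwardLimit s
      rw [h3]
      exact Ne.symm h1
    rw [← ENNReal.div_eq_inv_mul]
    exact (ENNReal.le_div_iff_mul_le (Or.inl (e.limitLaw_singleton_pos hα z).ne')
      (Or.inl (measure_ne_top _ _))).2 h1
  have h2 := ENNReal.Tendsto.const_mul (a := (e.limitLaw {z})⁻¹) hlim
    (Or.inr (ENNReal.inv_ne_top.2 (e.limitLaw_singleton_pos hα z).ne'))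
  rw [mul_zero] at h2
  exact tendsto_of_tendsto_of_tendsto_of_le_of_le tendsto_const_nhds h2 (fun _ => zero_le) hle

/-- Convergence holds from `0` by eventual constancy; the coupling error bounds the difference for
another start. -/
theorem tendsto_stepProb (hα : 0 < e.alpha) (z k : ℕ) :
    Tendsto (fun n => e.stepProb n z k) atTop (𝓝 (e.limitLaw {k})) := by
  have h0 : Tendsto (fun n => e.stepProb n 0 k) atTop (𝓝 (e.limitLaw {k})) := by
    rw [limitLaw_singleton]
    refine tendsto_measure_of_ae_tendsto_indicator_of_isFiniteMeasure _
      (measurable_backwardLimit (measurableSet_singleton k))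
      (fun n => measurable_backward 0 n (measurableSet_singleton k)) ?_
    filter_upwards [e.ae_goodStacks, e.ae_backwardBounded hα] with s hs hb
    filter_upwards [hb.eventually_eq hs] with n hn
    simp [hn]
  have hd := e.tendsto_stackLaw_backward_ne hα z
  have hub := h0.add hd
  have hlb := ENNReal.Tendsto.sub h0 hd (Or.inr (by simp))
  rw [add_zero] at hub
  rw [tsub_zero] at hlb
  refine tendsto_of_tendsto_of_tendsto_of_le_of_le hlb hub (fun n => ?_) fun n => ?_
  · refine tsub_le_iff_right.2 ((measure_mono fun s hs => ?_).trans (measure_union_le _ _))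
    by_cases h : backward z n s = backward 0 n s
    · exact Or.inl (h.trans hs)
    · exact Or.inr h
  · refine (measure_mono fun s hs => ?_).trans (measure_union_le _ _)
    by_cases h : backward z n s = backward 0 n s
    · exact Or.inl (h.symm.trans hs)
    · exact Or.inr h

theorem IsInvariant.tsum_stepProb {e : CookieEnvironment M} {ν : Measure ℕ} (h : e.IsInvariant ν)
    (n k : ℕ) :
    ∑' z, e.stepProb n z k * ν {z} = ν {k} := by
  induction n generalizing k with
  | zero =>
    simp_rw [stepProb_zero]
    rw [tsum_eq_single k fun z hz => by simp [hz]]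
    simp
  | succ n ih =>
    simp_rw [stepProb_succ, ← ENNReal.tsum_mul_right]
    rw [ENNReal.tsum_comm, ← h k]
    refine tsum_congr fun j => ?_
    rw [← ih j, ← ENNReal.tsum_mul_right]
    exact tsum_congr fun z => by ring

theorem isInvariant_iff (hα : 0 < e.alpha) (ν : Measure ℕ) [IsProbabilityMeasure ν] :
    e.IsInvariant ν ↔ ν = e.limitLaw := by
  constructor
  · intro h
    refine Measure.ext_of_singleton fun k => ?_
    -- By invariance these integrals all equal `ν {k}`, while dominated convergence sends them to
    -- the mass of the limit law.
    have h1 : Tendsto (fun n => ∫⁻ z, e.stepProb n z k ∂ν) atTop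
        (𝓝 (∫⁻ _, e.limitLaw {k} ∂ν)) :=
      tendsto_lintegral_of_dominated_convergence (fun _ => 1) (fun n => measurable_from_top)
        (fun n => Eventually.of_forall fun z => prob_le_one) (by simp)
        (Eventually.of_forall fun z => e.tendsto_stepProb hα z k)
    simp_rw [lintegral_countable', h.tsum_stepProb] at h1
    have h2 := tendsto_nhds_unique tendsto_const_nhds h1
    rw [h2, ← lintegral_countable']
    simp
  · rintro rfl
    exact e.isInvariant_limitLaw hα

theorem IsAssociatedChain.measure_eq {e : CookieEnvironment M} {Ω : Type*} [MeasurableSpace Ω]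
    {μ : Measure Ω} [IsProbabilityMeasure μ] {z : ℕ} {Z : ℕ → Ω → ℕ}
    (hZ : e.IsAssociatedChain z Z μ) (n k : ℕ) :
    μ {ω | Z n ω = k} = e.stepProb n z k := by
  induction n generalizing k with
  | zero =>
    rw [stepProb_zero]
    split_ifs with h
    · subst h
      rw [← measure_univ (μ := μ)]
      exact measure_congr (eventuallyEq_univ.2 hZ.start)
    · refine measure_mono_null (fun ω hω => ?_) (ae_iff.1 hZ.start)
      exact fun hc => h (hc.symm.trans hω)
  | succ n ih =>
    -- The Markov property is given for whole histories, which form a countable set; summing over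
    -- them leaves only the last state.
    set H : Ω → Fin (n + 1) → ℕ := fun ω i => Z i ω with hH
    have hHm : Measurable H := measurable_pi_lambda _ fun i => hZ.measurable i
    have hext : ∀ h : Fin (n + 1) → ℕ, {ω | H ω = h} =
        {ω | ∀ i ≤ n, Z i ω = (fun i => if hi : i < n + 1 then h ⟨i, hi⟩ else 0) i} := by
      intro h
      ext ω
      simp only [Set.mem_ofPred_eq, hH, funext_iff]
      constructor
      · intro hω i hi
        rw [dif_pos (Nat.lt_succ_of_le hi), ← hω]
      · intro hω i
        have := hω i (Nat.le_of_lt_succ i.2)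
        rwa [dif_pos i.2] at this
    have hstep : ∀ h : Fin (n + 1) → ℕ, μ ({ω | H ω = h} ∩ {ω | Z (n + 1) ω = k}) =
        e.transition (h (Fin.last n)) k * μ {ω | H ω = h} := by
      intro h
      have := hZ.markov n (fun i => if hi : i < n + 1 then h ⟨i, hi⟩ else 0) k
      rw [hext h]
      refine Eq.trans ?_ (this.trans ?_)
      · rfl
      · rw [dif_pos (Nat.lt_succ_self n)]
        rfl
    rw [measure_eq_tsum_fiber hHm]
    simp_rw [hstep]
    rw [← lintegral_comp_eq_tsum hHm fun h => e.transition (h (Fin.last n)) k]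
    have : ∀ ω, H ω (Fin.last n) = Z n ω := fun ω => rfl
    simp_rw [this]
    rw [lintegral_comp_eq_tsum (hZ.measurable n) fun j => e.transition j k, stepProb_succ]
    exact tsum_congr fun j => by rw [ih j, mul_comm]

theorem IsAssociatedChain.tendstoInDistribution {e : CookieEnvironment M} (hα : 0 < e.alpha)
    {Ω : Type*} [MeasurableSpace Ω] {μ : Measure Ω} [IsProbabilityMeasure μ] {z : ℕ}
    {Z : ℕ → Ω → ℕ} (hZ : e.IsAssociatedChain z Z μ) :
    TendstoInDistribution Z atTop id (fun _ => μ) e.limitLaw where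
  forall_aemeasurable n := (hZ.measurable n).aemeasurable
  aemeasurable_limit := aemeasurable_id
  tendsto := by
    refine tendsto_probabilityMeasure_nat fun k => ?_
    have h := e.tendsto_stepProb hα z k
    simp_rw [← hZ.measure_eq] at h
    refine (h.congr fun n => ?_).trans (le_of_eq ?_)
    · exact (Measure.map_apply (hZ.measurable n) (measurableSet_singleton k)).symm
    · simp

end CookieEnvironment

/-! ### Deterministic bounds for the walk driven by stacks of coins -/

section StackWalk

/-- The position after `n` steps, and the numbers of previous visits to each site, of the walk that
starts at `0` and uses the `k`-th coin `ξ x k` of the site `x` at its `k`-th visit to `x`. -/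
def walkState (ξ : ℤ → ℕ → Bool) : ℕ → ℤ × (ℤ → ℕ)
  | 0 => (0, fun _ => 0)
  | n + 1 =>
    ((walkState ξ n).1 + if ξ (walkState ξ n).1 ((walkState ξ n).2 (walkState ξ n).1) = true
      then 1 else -1,
    Function.update (walkState ξ n).2 (walkState ξ n).1
      ((walkState ξ n).2 (walkState ξ n).1 + 1))

/-- The position of the walk driven by the coins `ξ`. -/
def walkPos (ξ : ℤ → ℕ → Bool) (n : ℕ) : ℤ := (walkState ξ n).1

/-- The number of visits to `x` strictly before time `n`. -/
def visits (ξ : ℤ → ℕ → Bool) (n : ℕ) (x : ℤ) : ℕ := (walkState ξ n).2 x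

/-- The coin used by the walk at time `n`. -/
def currentCoin (ξ : ℤ → ℕ → Bool) (n : ℕ) : Bool := ξ (walkPos ξ n) (visits ξ n (walkPos ξ n))

/-- The number of jumps to the left from `x` before time `n`. -/
def leftJumps (ξ : ℤ → ℕ → Bool) (n : ℕ) (x : ℤ) : ℕ := tails (visits ξ n x) (ξ x)

/-- The number of jumps to the right from `x` before time `n`. -/
def rightJumps (ξ : ℤ → ℕ → Bool) (n : ℕ) (x : ℤ) : ℕ := heads (visits ξ n x) (ξ x)

variable {ξ : ℤ → ℕ → Bool} {n : ℕ} {x : ℤ}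

theorem walkPos_zero (ξ : ℤ → ℕ → Bool) : walkPos ξ 0 = 0 := rfl

theorem walkPos_succ (ξ : ℤ → ℕ → Bool) (n : ℕ) :
    walkPos ξ (n + 1) = walkPos ξ n + if currentCoin ξ n = true then 1 else -1 := rfl

theorem visits_succ (ξ : ℤ → ℕ → Bool) (n : ℕ) (x : ℤ) :
    visits ξ (n + 1) x = visits ξ n x + if x = walkPos ξ n then 1 else 0 := by
  change Function.update (walkState ξ n).2 _ _ x = _
  rw [Function.update_apply]
  by_cases h : x = (walkState ξ n).1
  · subst h
    simp [walkPos, visits]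
  · rw [if_neg h, if_neg (show ¬ x = walkPos ξ n from h)]
    rfl

theorem visits_eq_card (ξ : ℤ → ℕ → Bool) (n : ℕ) (x : ℤ) :
    visits ξ n x = ((Finset.range n).filter fun i => walkPos ξ i = x).card := by
  induction n with
  | zero => rfl
  | succ n ih =>
    rw [visits_succ, ih, Finset.range_add_one, Finset.filter_insert]
    by_cases h : x = walkPos ξ n
    · rw [if_pos h, if_pos h.symm, Finset.card_insert_of_notMem (by simp)]
    · rw [if_neg h, if_neg (Ne.symm h), add_zero]

theorem leftJumps_zero (ξ : ℤ → ℕ → Bool) (x : ℤ) : leftJumps ξ 0 x = 0 := rfl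

theorem rightJumps_zero (ξ : ℤ → ℕ → Bool) (x : ℤ) : rightJumps ξ 0 x = 0 := rfl

theorem leftJumps_succ (ξ : ℤ → ℕ → Bool) (n : ℕ) (x : ℤ) :
    leftJumps ξ (n + 1) x =
      leftJumps ξ n x + if x = walkPos ξ n ∧ currentCoin ξ n = false then 1 else 0 := by
  unfold leftJumps
  rw [visits_succ]
  by_cases h : x = walkPos ξ n
  · subst h
    rw [if_pos rfl, tails_succ]
    change _ + (if currentCoin ξ n = true then 0 else 1) = _
    cases currentCoin ξ n <;> simp
  · rw [if_neg h, if_neg fun hc => h hc.1]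
    rfl

theorem rightJumps_succ (ξ : ℤ → ℕ → Bool) (n : ℕ) (x : ℤ) :
    rightJumps ξ (n + 1) x =
      rightJumps ξ n x + if x = walkPos ξ n ∧ currentCoin ξ n = true then 1 else 0 := by
  unfold rightJumps
  rw [visits_succ]
  by_cases h : x = walkPos ξ n
  · subst h
    rw [if_pos rfl, heads_succ]
    change _ + (if currentCoin ξ n = true then 1 else 0) = _
    cases currentCoin ξ n <;> simp
  · rw [if_neg h, if_neg fun hc => h hc.1]
    rfl

/-- Conservation of the flow through the edge `{x, x + 1}`. -/
theorem rightJumps_sub_leftJumps (ξ : ℤ → ℕ → Bool) (n : ℕ) (x : ℤ) :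
    (rightJumps ξ n x : ℤ) - leftJumps ξ n (x + 1) =
      (if 0 ≤ x ∧ x < walkPos ξ n then 1 else 0) -
        if walkPos ξ n ≤ x ∧ x < 0 then 1 else 0 := by
  induction n with
  | zero =>
    rw [rightJumps_zero, leftJumps_zero, walkPos_zero]
    split_ifs <;> omega
  | succ n ih =>
    rw [rightJumps_succ, leftJumps_succ, walkPos_succ]
    cases currentCoin ξ n <;> simp <;> split_ifs at * <;> omega

/-- When the walk stands at `x`, the flow identity bounds the right jumps from `x` by the left jumps
from `x + 1`, hence by `V (x + 1)`. So even after the left jump at most `V (x + 1)` successes have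
been seen at `x`, and thus at most `V x` failures. -/
theorem leftJumps_le (hξ : ∀ x, InfinitelyManyHeads (ξ x)) {V : ℤ → ℕ}
    (hV : ∀ x, V x = failures (V (x + 1)) (ξ x)) (n : ℕ) (x : ℤ) : leftJumps ξ n x ≤ V x := by
  induction n generalizing x with
  | zero => exact Nat.zero_le _
  | succ n ih =>
    by_cases h : x = walkPos ξ n ∧ currentCoin ξ n = false
    · obtain ⟨hx, hc⟩ := h
      have hflow := rightJumps_sub_leftJumps ξ n x
      have h1 : rightJumps ξ (n + 1) x = rightJumps ξ n x := by
        rw [rightJumps_succ, if_neg (by rw [hc]; simp), add_zero]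
      have h2 := ih (x + 1)
      have h3 : rightJumps ξ (n + 1) x ≤ V (x + 1) := by
        split_ifs at hflow <;> omega
      rw [hV x]
      exact (hξ x).tails_le_failures h3
    · rw [leftJumps_succ, if_neg h, add_zero]
      exact ih x

/-- The edge to the right of `x` has been crossed once more rightward than leftward, which supplies
the extra success required by `failures`. -/
theorem failures_le_leftJumps (h0 : 0 ≤ x) (hx : x < walkPos ξ n) :
    failures (leftJumps ξ n (x + 1)) (ξ x) ≤ leftJumps ξ n x := by
  have hflow := rightJumps_sub_leftJumps ξ n x
  rw [if_pos ⟨h0, hx⟩, if_neg (by omega)] at hflow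
  refine failures_le_tails ?_
  change _ ≤ rightJumps ξ n x
  omega

theorem backward_le_leftJumps (hξ : ∀ x, InfinitelyManyHeads (ξ x)) (k : ℕ) (h0 : 0 ≤ x)
    (hx : x + k ≤ walkPos ξ n) : backward 0 k (fun i => ξ (x + i)) ≤ leftJumps ξ n x := by
  induction k generalizing x with
  | zero => exact Nat.zero_le _
  | succ k ih =>
    refine le_trans ?_ (failures_le_leftJumps h0 (by push_cast at hx; omega))
    have h1 := ih (x := x + 1) (by omega) (by push_cast at hx; omega)
    have h2 : seqShift (fun i : ℕ => ξ (x + i)) = fun i : ℕ => ξ (x + 1 + i) := by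
      funext i
      simp only [seqShift]
      congr 1
      push_cast
      ring
    simp only [backward, h2, Nat.cast_zero, add_zero]
    exact (hξ x).failures_mono h1

/-- Elapsed time in terms of the position and of the jumps to the left. -/
theorem time_eq (I : Finset ℤ) (hI : ∀ m < n, walkPos ξ m ∈ I) :
    (n : ℤ) = walkPos ξ n + 2 * ∑ x ∈ I, (leftJumps ξ n x : ℤ) := by
  induction n with
  | zero => simp [walkPos_zero, leftJumps_zero]
  | succ n ih =>
    have h := ih fun m hm => hI m (by omega)
    simp_rw [leftJumps_succ, Nat.cast_add]
    rw [Finset.sum_add_distrib, walkPos_succ]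
    have hsum : ∑ x ∈ I, ((if x = walkPos ξ n ∧ currentCoin ξ n = false then 1 else 0 : ℕ) : ℤ) =
        if currentCoin ξ n = true then 0 else 1 := by
      rw [Finset.sum_eq_single (walkPos ξ n)]
      · cases currentCoin ξ n <;> simp
      · intro x _ hx
        rw [if_neg fun hc => hx hc.1]
        rfl
      · intro hc
        exact absurd (hI n (Nat.lt_succ_self n)) hc
    rw [hsum]
    split_ifs <;> push_cast <;> linarith

theorem abs_walkPos_le (ξ : ℤ → ℕ → Bool) (n : ℕ) : |walkPos ξ n| ≤ n := by
  induction n with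
  | zero => simp [walkPos_zero]
  | succ n ih =>
    rw [walkPos_succ]
    rw [abs_le] at ih ⊢
    push_cast
    split_ifs <;> omega

/-- A lower bound on the time needed to stand at `m`: in `time_eq`, only the left jumps from the
sites `0, …, m - 1` are kept. -/
theorem walkPos_add_sum_backward_le (hξ : ∀ x, InfinitelyManyHeads (ξ x)) {m : ℕ}
    (hm : walkPos ξ n = m) :
    m + 2 * ∑ i ∈ Finset.range m, backward 0 (m - i) (fun k => ξ (i + k)) ≤ n := by
  have h1 := time_eq (ξ := ξ) (n := n) (Finset.Icc (-n : ℤ) n) fun k hk => by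
    have := abs_le.1 (abs_walkPos_le ξ k)
    exact Finset.mem_Icc.2 ⟨by omega, by omega⟩
  have h2 : ∑ i ∈ Finset.range m, (leftJumps ξ n i : ℤ) ≤
      ∑ x ∈ Finset.Icc (-n : ℤ) n, (leftJumps ξ n x : ℤ) := by
    have hinj : Set.InjOn (fun i : ℕ => (i : ℤ)) (Finset.range m) :=
      Nat.cast_injective.injOn
    rw [← Finset.sum_image (f := fun x : ℤ => (leftJumps ξ n x : ℤ)) hinj]
    refine Finset.sum_le_sum_of_subset_of_nonneg ?_ fun _ _ _ => Int.natCast_nonneg _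
    intro x hx
    obtain ⟨i, hi, rfl⟩ := Finset.mem_image.1 hx
    have := abs_le.1 (abs_walkPos_le ξ n)
    have := Finset.mem_range.1 hi
    exact Finset.mem_Icc.2 ⟨by omega, by omega⟩
  have h3 : ∑ i ∈ Finset.range m, backward 0 (m - i) (fun k => ξ (i + k)) ≤
      ∑ i ∈ Finset.range m, leftJumps ξ n i := by
    refine Finset.sum_le_sum fun i hi => ?_
    have := Finset.mem_range.1 hi
    exact backward_le_leftJumps hξ (m - i) (by omega) (by omega)
  zify at h3 ⊢
  linarith

/-- A site with `V x = 0` is never left to the left, so it is a barrier. -/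
theorem le_walkPos (hξ : ∀ x, InfinitelyManyHeads (ξ x)) {V : ℤ → ℕ}
    (hV : ∀ x, V x = failures (V (x + 1)) (ξ x)) (hx : x ≤ 0) (hx0 : V x = 0) (n : ℕ) :
    x ≤ walkPos ξ n := by
  induction n with
  | zero => exact hx
  | succ n ih =>
    have h1 := leftJumps_le hξ hV (n + 1) x
    rw [leftJumps_succ, hx0] at h1
    rw [walkPos_succ]
    by_cases hc : currentCoin ξ n = true
    · rw [if_pos hc]; omega
    · have : x ≠ walkPos ξ n := by
        intro he
        rw [if_pos ⟨he, by simpa using hc⟩] at h1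
        omega
      rw [if_neg hc]; omega

theorem le_walkPos_add_sum (hξ : ∀ x, InfinitelyManyHeads (ξ x)) {V : ℤ → ℕ}
    (hV : ∀ x, V x = failures (V (x + 1)) (ξ x)) (hx : x ≤ 0) (hx0 : V x = 0) {m : ℕ}
    (hm : ∀ k < n, walkPos ξ k < m) :
    (n : ℤ) ≤ walkPos ξ n +
      2 * (∑ y ∈ Finset.Ico x 0, (V y : ℤ) + ∑ i ∈ Finset.range m, (V i : ℤ)) := by
  have h1 := time_eq (ξ := ξ) (n := n) (Finset.Ico x m) fun k hk =>
    Finset.mem_Ico.2 ⟨le_walkPos hξ hV hx hx0 k, hm k hk⟩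
  have h2 : ∑ y ∈ Finset.Ico x m, (leftJumps ξ n y : ℤ) ≤ ∑ y ∈ Finset.Ico x m, (V y : ℤ) :=
    Finset.sum_le_sum fun y _ => Nat.cast_le.2 (leftJumps_le hξ hV n y)
  have h3 : Finset.Ico x (m : ℤ) =
      Finset.Ico x 0 ∪ (Finset.range m).image fun i : ℕ => (i : ℤ) := by
    ext y
    simp only [Finset.mem_Ico, Finset.mem_union, Finset.mem_image, Finset.mem_range]
    constructor
    · intro h
      by_cases hy : y < 0
      · exact Or.inl ⟨h.1, hy⟩
      · exact Or.inr ⟨y.toNat, by omega, by omega⟩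
    · rintro (h | ⟨i, hi, rfl⟩) <;> omega
  have h4 : ∑ y ∈ Finset.Ico x (m : ℤ), (V y : ℤ) =
      ∑ y ∈ Finset.Ico x 0, (V y : ℤ) + ∑ i ∈ Finset.range m, (V i : ℤ) := by
    rw [h3, Finset.sum_union, Finset.sum_image Nat.cast_injective.injOn]
    rw [Finset.disjoint_left]
    intro y hy hy'
    obtain ⟨i, -, rfl⟩ := Finset.mem_image.1 hy'
    have := Finset.mem_Ico.1 hy
    omega
  linarith

/-- A bound from below on the time needed to travel a distance bounds the positions. -/
theorem walkPos_le_of_forall_le (hξ : ∀ x, InfinitelyManyHeads (ξ x)) {c K : ℝ} (hc : 0 < c)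
    (hK : 0 ≤ K) (h : ∀ m : ℕ, c * m - K ≤
      m + 2 * ∑ i ∈ Finset.range m, (backward 0 (m - i) (fun k => ξ (i + k)) : ℝ)) (n : ℕ) :
    (walkPos ξ n : ℝ) ≤ (n + K) / c := by
  rw [le_div_iff₀ hc]
  rcases le_or_gt 0 (walkPos ξ n) with h0 | h0
  · obtain ⟨m, hm⟩ := Int.eq_ofNat_of_zero_le h0
    have h1 := walkPos_add_sum_backward_le hξ hm
    have h2 := h m
    rw [hm]
    have h3 : (m : ℝ) + 2 * ∑ i ∈ Finset.range m, (backward 0 (m - i) (fun k => ξ (i + k)) : ℝ) ≤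
        n := by exact_mod_cast h1
    push_cast
    linarith
  · have h1 : (walkPos ξ n : ℝ) < 0 := by exact_mod_cast h0
    have h2 : (walkPos ξ n : ℝ) * c ≤ 0 := mul_nonpos_of_nonpos_of_nonneg h1.le hc.le
    have h3 : (0 : ℝ) ≤ n := Nat.cast_nonneg n
    linarith

/-- A lower bound on the position of the walk, with `c` a lower bound for the inverse speed and `d`
an upper bound for the mean of `V`. -/
theorem le_walkPos_of_forall_le (hξ : ∀ x, InfinitelyManyHeads (ξ x)) {V : ℤ → ℕ}
    (hV : ∀ x, V x = failures (V (x + 1)) (ξ x)) (hx : x ≤ 0) (hx0 : V x = 0) {c d K : ℝ}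
    (hc : 0 < c) (hd : 0 ≤ d) (hK : 0 ≤ K) (h : ∀ m : ℕ, c * m - K ≤
      m + 2 * ∑ i ∈ Finset.range m, (backward 0 (m - i) (fun k => ξ (i + k)) : ℝ))
    (h' : ∀ m : ℕ, ∑ i ∈ Finset.range m, (V i : ℝ) ≤ d * m + K) (n : ℕ) :
    n - 2 * (∑ y ∈ Finset.Ico x 0, (V y : ℝ) + d * ((n + K) / c + 1) + K) ≤ walkPos ξ n := by
  -- By `walkPos_le_of_forall_le` no position before time `n` exceeds `(n + K) / c`, so this `m`
  -- lies strictly to the right of all of them.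
  set m : ℕ := ⌊(n + K) / c⌋₊ + 1 with hm
  have h0 : 0 ≤ (n + K) / c := by positivity
  have hlt : ∀ k < n, walkPos ξ k < m := by
    intro k hk
    have h1 := walkPos_le_of_forall_le hξ hc hK h k
    have h2 : ((k : ℝ) + K) / c ≤ (n + K) / c := by
      have : (k : ℝ) ≤ n := by exact_mod_cast hk.le
      gcongr
    have h3 := Nat.lt_floor_add_one ((n + K) / c)
    have h4 : (walkPos ξ k : ℝ) < (m : ℕ) := by
      rw [hm]; push_cast; linarith
    exact_mod_cast h4
  have h1 := le_walkPos_add_sum hξ hV hx hx0 hlt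
  have h2 : (n : ℝ) ≤ walkPos ξ n +
      2 * (∑ y ∈ Finset.Ico x 0, (V y : ℝ) + ∑ i ∈ Finset.range m, (V i : ℝ)) := by
    exact_mod_cast h1
  have h3 : (m : ℝ) ≤ (n + K) / c + 1 := by
    rw [hm]; push_cast
    linarith [Nat.floor_le h0]
  have h4 := mul_le_mul_of_nonneg_left h3 hd
  linarith [h' m]

end StackWalk

/-! ### Identification of the law of a cookie random walk -/

namespace CookieEnvironment

section LawOfWalk

theorem setOf_history_succ {Ω : Type*} (W : ℕ → Ω → ℤ) (n : ℕ) (x : ℕ → ℤ) :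
    {ω | ∀ i ≤ n + 1, W i ω = x i} =
      {ω | (∀ i ≤ n, W i ω = x i) ∧ W (n + 1) ω = x (n + 1)} := by
  ext ω
  constructor
  · exact fun h => ⟨fun i hi => h i (by omega), h _ le_rfl⟩
  · rintro ⟨h1, h2⟩ i hi
    rcases Nat.lt_or_ge n i with h | h
    · rwa [show i = n + 1 by omega]
    · exact h1 i h

variable {M : ℕ} {e : CookieEnvironment M} {Ω Ω₂ : Type*} [MeasurableSpace Ω] [MeasurableSpace Ω₂]
  {μ : Measure Ω} {ρ : Measure Ω₂} {z : ℤ} {X : ℕ → Ω → ℤ} {Y : ℕ → Ω₂ → ℤ}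

theorem IsCookieWalk.measurableSet_history (hX : e.IsCookieWalk z X μ) (n : ℕ) (x : ℕ → ℤ) :
    MeasurableSet {ω | ∀ i ≤ n, X i ω = x i} := by
  simp only [Set.ofPred_forall]
  exact MeasurableSet.iInter fun i => MeasurableSet.iInter fun _ =>
    hX.measurable i (measurableSet_singleton _)

theorem IsCookieWalk.step_other (hX : e.IsCookieWalk z X μ) {n : ℕ} {x : ℕ → ℤ} {y : ℤ}
    (hr : y ≠ x n + 1) (hl : y ≠ x n - 1) :
    μ {ω | (∀ i ≤ n, X i ω = x i) ∧ X (n + 1) ω = y} = 0 := by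
  rw [measure_eq_zero_iff_ae_notMem]
  filter_upwards [hX.nearest_neighbour n] with ω hω h
  have h1 := h.1 n le_rfl
  have h2 := h.2
  rcases (abs_eq zero_le_one).1 hω with h | h <;> omega

variable [IsProbabilityMeasure μ] [IsProbabilityMeasure ρ]

theorem IsCookieWalk.measure_history_zero (hX : e.IsCookieWalk z X μ) (x : ℕ → ℤ) :
    μ {ω | ∀ i ≤ 0, X i ω = x i} = if z = x 0 then 1 else 0 := by
  split_ifs with h
  · rw [← measure_univ (μ := μ)]
    refine measure_congr (eventuallyEq_univ.2 ?_)
    filter_upwards [hX.start] with ω hω i hi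
    rw [Nat.le_zero.1 hi, hω, h]
  · rw [measure_eq_zero_iff_ae_notMem]
    filter_upwards [hX.start] with ω hω hc
    exact h (hω.symm.trans (hc 0 le_rfl))

/-- Only right jumps have a prescribed probability; the nearest-neighbour condition makes left jumps
their complement. -/
theorem IsCookieWalk.step_left (hX : e.IsCookieWalk z X μ) (n : ℕ) (x : ℕ → ℤ) :
    μ {ω | (∀ i ≤ n, X i ω = x i) ∧ X (n + 1) ω = x n - 1} =
      μ {ω | ∀ i ≤ n, X i ω = x i} -
        ENNReal.ofReal (e.strength ((Finset.range n).filter fun i => x i = x n).card) *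
          μ {ω | ∀ i ≤ n, X i ω = x i} := by
  rw [← hX.step n x, ← measure_sdiff]
  · refine measure_congr ?_
    filter_upwards [hX.nearest_neighbour n] with ω hω
    refine propext ⟨?_, ?_⟩
    · rintro ⟨h1, h2⟩
      exact ⟨h1, fun h3 => by have := h3.2; omega⟩
    · rintro ⟨h1, h2⟩
      refine ⟨h1, ?_⟩
      have h3 : X (n + 1) ω ≠ x n + 1 := fun h3 => h2 ⟨h1, h3⟩
      have h4 := h1 n le_rfl
      rcases (abs_eq zero_le_one).1 hω with h | h <;> omega
  · exact fun ω h => h.1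
  · exact ((hX.measurableSet_history n x).inter
      (hX.measurable (n + 1) (measurableSet_singleton _))).nullMeasurableSet
  · exact measure_ne_top _ _

theorem IsCookieWalk.measure_history_eq (hX : e.IsCookieWalk z X μ) (hY : e.IsCookieWalk z Y ρ)
    (n : ℕ) (x : ℕ → ℤ) :
    μ {ω | ∀ i ≤ n, X i ω = x i} = ρ {ω | ∀ i ≤ n, Y i ω = x i} := by
  induction n with
  | zero => rw [hX.measure_history_zero, hY.measure_history_zero]
  | succ n ih =>
    rw [setOf_history_succ, setOf_history_succ]
    by_cases hr : x (n + 1) = x n + 1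
    · rw [hr, hX.step, hY.step, ih]
    · by_cases hl : x (n + 1) = x n - 1
      · rw [hl, hX.step_left, hY.step_left, ih]
      · rw [hX.step_other hr hl, hY.step_other hr hl]

/-- The law of a cookie random walk is determined by the environment and the starting point. -/
theorem IsCookieWalk.map_eq (hX : e.IsCookieWalk z X μ) (hY : e.IsCookieWalk z Y ρ) :
    μ.map (fun ω n => X n ω) = ρ.map (fun ω n => Y n ω) := by
  have hXm : Measurable fun ω n => X n ω := measurable_pi_lambda _ hX.measurable
  have hYm : Measurable fun ω n => Y n ω := measurable_pi_lambda _ hY.measurable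
  have hproj := isProjectiveMeasureFamily_map_restrict fun t => (hY.measurable t).aemeasurable (μ := ρ)
  have : IsProbabilityMeasure (ρ.map fun ω n => Y n ω) :=
    Measure.isProbabilityMeasure_map hYm.aemeasurable
  -- The laws of initial segments determine the law of the path; those are measures on countable
  -- spaces, so masses of single histories suffice.
  refine IsProjectiveLimit.unique (P := fun I => ρ.map fun ω => I.restrict (Y · ω)) ?_ ?_
  · rw [isProjectiveLimit_nat_iff hproj]
    intro n
    have hr : Measurable ((Finset.Iic n).restrict : (ℕ → ℤ) → _) :=
      (Finset.Iic n).measurable_restrict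
    refine Measure.ext_of_singleton fun f => ?_
    change ((μ.map fun ω n => X n ω).map (Finset.Iic n).restrict) {f} = _
    rw [Measure.map_map hr hXm, Measure.map_apply (hr.comp hXm) (measurableSet_singleton f)]
    change _ = (ρ.map ((Finset.Iic n).restrict ∘ fun ω n => Y n ω)) {f}
    rw [Measure.map_apply (hr.comp hYm) (measurableSet_singleton f)]
    have h := hX.measure_history_eq hY n fun i =>
      if hi : i ∈ Finset.Iic n then f ⟨i, hi⟩ else 0
    have hset : ∀ g : ℕ → ℤ, (∀ i ≤ n, g i = if hi : i ∈ Finset.Iic n then f ⟨i, hi⟩ else 0) ↔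
        (Finset.Iic n).restrict g = f := by
      intro g
      rw [funext_iff]
      constructor
      · intro hg i
        have := hg i (Finset.mem_Iic.1 i.2)
        rwa [dif_pos i.2] at this
      · intro hg i hi
        rw [dif_pos (Finset.mem_Iic.2 hi)]
        exact hg ⟨i, Finset.mem_Iic.2 hi⟩
    simp only [hset] at h
    exact h
  · intro I
    rw [Measure.map_map I.measurable_restrict hYm]
    rfl

end LawOfWalk

section StackLaw

variable {M : ℕ} (e : CookieEnvironment M)

/-- The law of independent coins at the sites of `ℤ`. -/
noncomputable def siteLaw : Measure (ℤ → ℕ → Bool) := Measure.infinitePi fun _ => e.coinLaw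

instance : IsProbabilityMeasure e.siteLaw := by unfold siteLaw; infer_instance

theorem siteLaw_cylinder (n : ℕ) {q : ℕ → ℤ × ℕ} (hq : Set.InjOn q (Finset.range n))
    (c : ℕ → Bool) :
    e.siteLaw {ξ | ∀ i < n, ξ (q i).1 (q i).2 = c i} =
      ∏ i ∈ Finset.range n, e.coinProb (q i).2 (c i) := by
  classical
  have hcurry := Measure.infinitePi_map_curry (ι := ℤ) (κ := ℕ)
    (fun _ i => bernoulliMeasure true false ⟨e.strength i, e.strength_mem i⟩)
  have hlaw : e.siteLaw = _ := hcurry.symm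
  rw [hlaw, MeasurableEquiv.map_apply]
  -- The constraints are regrouped by coin; injectivity of `q` leaves exactly one at each coin
  -- involved.
  set t : ℤ × ℕ → Set Bool := fun p => {b | ∀ i < n, q i = p → b = c i} with ht
  have hset : MeasurableEquiv.curry ℤ ℕ Bool ⁻¹' {ξ | ∀ i < n, ξ (q i).1 (q i).2 = c i} =
      Set.pi ((Finset.range n).image q) t := by
    ext f
    simp only [Set.mem_preimage, Set.mem_ofPred_eq, Set.mem_pi, Finset.coe_image, ht,
      Set.forall_mem_image, Finset.coe_range, Set.mem_Iio]
    constructor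
    · intro h i hi j hj hij
      rw [← hij]
      exact h j hj
    · intro h i hi
      exact h hi i hi rfl
  rw [hset, Measure.infinitePi_pi _ fun _ _ => (Set.toFinite _).measurableSet,
    Finset.prod_image hq]
  refine Finset.prod_congr rfl fun i hi => ?_
  have hti : t (q i) = {c i} := by
    ext b
    simp only [ht, Set.mem_ofPred_eq, Set.mem_singleton_iff]
    constructor
    · exact fun h => h i (Finset.mem_range.1 hi) rfl
    · intro h j hj hij
      rw [h, hq (Finset.mem_coe.2 (Finset.mem_range.2 hj)) (Finset.mem_coe.2 hi) hij]
  rw [hti, bernoulliMeasure_singleton]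

/-- The site occupied at time `i` by the path `x`, with the number of its previous visits. -/
def pathCoin (x : ℕ → ℤ) (i : ℕ) : ℤ × ℕ := (x i, ((Finset.range i).filter fun k => x k = x i).card)

/-- No coin is used twice along a path; this is why the probability of a history factorizes. -/
theorem pathCoin_injective (x : ℕ → ℤ) : Function.Injective (pathCoin x) := by
  have key : ∀ i j, i < j → pathCoin x i ≠ pathCoin x j := by
    intro i j hij h
    have h1 : x i = x j := congrArg Prod.fst h
    have h2 : ((Finset.range i).filter fun k => x k = x i).card =
        ((Finset.range j).filter fun k => x k = x j).card := congrArg Prod.snd h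
    refine (Finset.card_lt_card ?_).ne h2
    rw [h1, Finset.ssubset_iff_of_subset]
    · exact ⟨i, by simp [hij, h1], by simp⟩
    · intro k hk
      simp only [Finset.mem_filter, Finset.mem_range] at hk ⊢
      exact ⟨by omega, hk.2⟩
  intro i j h
  rcases lt_trichotomy i j with hij | hij | hij
  · exact absurd h (key i j hij)
  · exact hij
  · exact absurd h.symm (key j i hij)

theorem currentCoin_eq_of_history {ξ : ℤ → ℕ → Bool} {x : ℕ → ℤ} {i : ℕ}
    (h : ∀ k ≤ i, walkPos ξ k = x k) :
    currentCoin ξ i = ξ (pathCoin x i).1 (pathCoin x i).2 := by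
  unfold currentCoin pathCoin
  rw [visits_eq_card, h i le_rfl]
  have : (Finset.range i).filter (fun k => walkPos ξ k = x i) =
      (Finset.range i).filter fun k => x k = x i :=
    Finset.filter_congr fun k hk => by rw [h k (Finset.mem_range.1 hk).le]
  rw [this]

theorem history_iff {x : ℕ → ℤ} (h0 : x 0 = 0) {n : ℕ} (hx : ∀ i < n, |x (i + 1) - x i| = 1)
    (ξ : ℤ → ℕ → Bool) :
    (∀ i ≤ n, walkPos ξ i = x i) ↔
      ∀ i < n, ξ (pathCoin x i).1 (pathCoin x i).2 = decide (x (i + 1) = x i + 1) := by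
  constructor
  · intro h i hi
    rw [← currentCoin_eq_of_history fun k hk => h k (by omega)]
    have h1 := walkPos_succ ξ i
    rw [h _ (by omega), h _ hi.le] at h1
    rw [h1]
    cases currentCoin ξ i <;> simp
  · intro h i
    induction i using Nat.strong_induction_on with
    | _ i ih =>
      intro hi
      rcases i with _ | i
      · rw [walkPos_zero, h0]
      · rw [walkPos_succ, currentCoin_eq_of_history fun k hk => ih k (by omega) (by omega),
          h i (by omega), ih i (by omega) (by omega)]
        have := hx i (by omega)
        by_cases hc : x (i + 1) = x i + 1
        · simp [hc]
        · simp only [hc, decide_false, Bool.false_eq_true, if_false]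
          rcases (abs_eq zero_le_one).1 this with h | h <;> omega

theorem siteLaw_history {x : ℕ → ℤ} (h0 : x 0 = 0) {n : ℕ} (hx : ∀ i < n, |x (i + 1) - x i| = 1) :
    e.siteLaw {ξ | ∀ i ≤ n, walkPos ξ i = x i} =
      ∏ i ∈ Finset.range n, e.coinProb (pathCoin x i).2 (decide (x (i + 1) = x i + 1)) := by
  simp_rw [history_iff h0 hx]
  exact e.siteLaw_cylinder n (pathCoin_injective x).injOn _

theorem measurable_walkState (n : ℕ) :
    (Measurable fun ξ => walkPos ξ n) ∧ ∀ x, Measurable fun ξ => visits ξ n x := by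
  induction n with
  | zero => exact ⟨measurable_const, fun _ => measurable_const⟩
  | succ n ih =>
    obtain ⟨hp, hv⟩ := ih
    have hcoin : Measurable fun ξ : ℤ → ℕ → Bool => currentCoin ξ n := by
      have h1 : ∀ p : ℤ, Measurable fun ξ : ℤ → ℕ → Bool => ξ p (visits ξ n p) := by
        intro p
        have h2 : Measurable fun q : ℕ × (ℤ → ℕ → Bool) => q.2 p q.1 :=
          measurable_from_prod_countable_right fun k =>
            (measurable_pi_apply k).comp (measurable_pi_apply p)
        exact h2.comp ((hv p).prodMk measurable_id)
      have h3 : Measurable fun q : ℤ × (ℤ → ℕ → Bool) => q.2 q.1 (visits q.2 n q.1) :=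
        measurable_from_prod_countable_right h1
      exact h3.comp (hp.prodMk measurable_id)
    constructor
    · simp_rw [walkPos_succ]
      exact hp.add ((measurable_from_top (f := fun c : Bool => if c = true then (1 : ℤ) else -1)).comp
        hcoin)
    · intro x
      simp_rw [visits_succ]
      exact (hv x).add ((measurable_from_top (f := fun p : ℤ => if x = p then 1 else 0)).comp hp)

/-- The walk driven by independent coins is a cookie random walk. -/
theorem isCookieWalk_walkPos : e.IsCookieWalk 0 (fun n ξ => walkPos ξ n) e.siteLaw where
  measurable n := (measurable_walkState n).1
  start := Eventually.of_forall fun ξ => rfl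
  nearest_neighbour n := Eventually.of_forall fun ξ => by
    rw [walkPos_succ]
    split_ifs <;> simp
  step n x := by
    -- An inadmissible history has probability zero, so both sides vanish. An admissible one is
    -- extended by a right step to `y`, which adds one factor to the product.
    by_cases hadm : x 0 = 0 ∧ ∀ i < n, |x (i + 1) - x i| = 1
    · obtain ⟨h0, hx⟩ := hadm
      set y : ℕ → ℤ := fun i => if i ≤ n then x i else x n + 1 with hy
      have hyx : ∀ i ≤ n, y i = x i := fun i hi => if_pos hi
      have hyn : y (n + 1) = x n + 1 := if_neg (by omega)
      have hset : {ξ | (∀ i ≤ n, walkPos ξ i = x i) ∧ walkPos ξ (n + 1) = x n + 1} =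
          {ξ | ∀ i ≤ n + 1, walkPos ξ i = y i} := by
        ext ξ
        constructor
        · rintro ⟨h1, h2⟩ i hi
          rcases Nat.lt_or_ge n i with h | h
          · rw [show i = n + 1 by omega, h2, hyn]
          · rw [h1 i h, hyx i h]
        · intro h
          exact ⟨fun i hi => by rw [h i (by omega), hyx i hi], by rw [h _ le_rfl, hyn]⟩
      have hyadm : ∀ i < n + 1, |y (i + 1) - y i| = 1 := by
        intro i hi
        rcases Nat.lt_or_ge i n with h | h
        · rw [hyx _ (by omega), hyx _ (by omega)]
          exact hx i h
        · rw [show i = n by omega, hyn, hyx n le_rfl]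
          simp
      have hcoin : ∀ i ≤ n, pathCoin y i = pathCoin x i := by
        intro i hi
        unfold pathCoin
        rw [hyx i hi]
        congr 2
        refine Finset.filter_congr fun k hk => ?_
        rw [hyx k (by have := Finset.mem_range.1 hk; omega)]
      rw [hset, e.siteLaw_history (by rw [hyx 0 (Nat.zero_le _), h0]) hyadm,
        e.siteLaw_history h0 hx, Finset.prod_range_succ, mul_comm]
      congr 1
      · rw [hcoin n le_rfl, hyn, hyx n le_rfl, decide_eq_true rfl, coinProb, if_pos rfl]
        rfl
      · refine Finset.prod_congr rfl fun i hi => ?_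
        have := Finset.mem_range.1 hi
        rw [hcoin i (by omega), hyx _ (by omega), hyx _ (by omega)]
    · have hempty : {ξ | ∀ i ≤ n, walkPos ξ i = x i} = ∅ := by
        ext ξ
        simp only [Set.mem_ofPred_eq, Set.mem_empty_iff_false, iff_false]
        intro h
        refine hadm ⟨by rw [← h 0 (Nat.zero_le _), walkPos_zero], fun i hi => ?_⟩
        rw [← h i hi.le, ← h (i + 1) hi, walkPos_succ]
        split_ifs <;> simp
      have hempty' : {ξ | (∀ i ≤ n, walkPos ξ i = x i) ∧ walkPos ξ (n + 1) = x n + 1} = ∅ :=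
        Set.subset_empty_iff.1 (hempty ▸ fun ξ h => h.1)
      rw [hempty, hempty', measure_empty, mul_zero]

/-- An almost sure limit for the walk driven by independent coins holds for every cookie walk. -/
theorem IsCookieWalk.ae_tendsto {e : CookieEnvironment M} {Ω : Type*} [MeasurableSpace Ω]
    {μ : Measure Ω} [IsProbabilityMeasure μ] {X : ℕ → Ω → ℤ} (hX : e.IsCookieWalk 0 X μ) {v : ℝ}
    (h : ∀ᵐ ξ ∂e.siteLaw, Tendsto (fun n : ℕ => (walkPos ξ n : ℝ) / n) atTop (𝓝 v)) :
    ∀ᵐ ω ∂μ, Tendsto (fun n : ℕ => (X n ω : ℝ) / n) atTop (𝓝 v) := by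
  have hmeas : MeasurableSet {f : ℕ → ℤ | Tendsto (fun n : ℕ => (f n : ℝ) / n) atTop (𝓝 v)} := by
    refine measurableSet_tendsto (𝓝 v) fun n => ?_
    exact (measurable_from_top (f := fun k : ℤ => (k : ℝ) / n)).comp (measurable_pi_apply n)
  have hwm : Measurable fun ξ n => walkPos ξ n :=
    measurable_pi_lambda _ fun n => (measurable_walkState n).1
  have h1 := (ae_map_iff hwm.aemeasurable hmeas).2 h
  rw [← hX.map_eq e.isCookieWalk_walkPos] at h1
  exact ae_of_ae_map (measurable_pi_lambda _ hX.measurable).aemeasurable h1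

end StackLaw

end CookieEnvironment

/-! ### The ergodic theorem along the sites and the speed -/

/-- A sequence squeezed between two families of sequences whose limits are arbitrarily close to `v`
converges to `v`. -/
theorem tendsto_of_forall_le_of_forall_le {f : ℕ → ℝ} {v : ℝ} {l u : ℕ → ℕ → ℝ} {L U : ℕ → ℝ}
    (hl : ∀ j n, l j n ≤ f n) (hu : ∀ j n, f n ≤ u j n)
    (hlL : ∀ j, Tendsto (l j) atTop (𝓝 (L j))) (huU : ∀ j, Tendsto (u j) atTop (𝓝 (U j)))
    (hL : Tendsto L atTop (𝓝 v)) (hU : Tendsto U atTop (𝓝 v)) : Tendsto f atTop (𝓝 v) := by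
  refine tendsto_order.2 ⟨fun a ha => ?_, fun a ha => ?_⟩
  · obtain ⟨j, hj⟩ := (hL.eventually (lt_mem_nhds ha)).exists
    filter_upwards [(hlL j).eventually (lt_mem_nhds hj)] with n hn
    exact hn.trans_le (hl j n)
  · obtain ⟨j, hj⟩ := (hU.eventually (gt_mem_nhds ha)).exists
    filter_upwards [(huU j).eventually (gt_mem_nhds hj)] with n hn
    exact (hu j n).trans_lt hn

/-- The limit of the backward compositions along the sites to the right of `x`. -/
noncomputable def siteLimit (ξ : ℤ → ℕ → Bool) (x : ℤ) : ℕ := backwardLimit fun i : ℕ => ξ (x + i)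

theorem seqShift_site (ξ : ℤ → ℕ → Bool) (x : ℤ) :
    seqShift (fun i : ℕ => ξ (x + i)) = fun i : ℕ => ξ (x + 1 + i) := by
  funext i
  simp only [seqShift]
  congr 1
  push_cast
  ring

theorem seqShift_iterate_site (ξ : ℤ → ℕ → Bool) (x : ℤ) (n : ℕ) :
    seqShift^[n] (fun i : ℕ => ξ (x + i)) = fun i : ℕ => ξ (x + n + i) := by
  rw [seqShift_iterate]
  funext i
  congr 1
  push_cast
  ring

namespace CookieEnvironment

variable {M : ℕ} (e : CookieEnvironment M)

theorem measurePreserving_site (x : ℤ) :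
    MeasurePreserving (fun (ξ : ℤ → ℕ → Bool) (i : ℕ) => ξ (x + i)) e.siteLaw e.stackLaw :=
  measurePreserving_reindex_infinitePi e.coinLaw fun i j h => by simpa using h

theorem ae_site_infinitelyManyHeads : ∀ᵐ ξ ∂e.siteLaw, ∀ x, InfinitelyManyHeads (ξ x) :=
  ae_all_iff.2 fun x =>
    (measurePreserving_eval_infinitePi (fun _ : ℤ => e.coinLaw) x).quasiMeasurePreserving.ae
      e.ae_infinitelyManyHeads

/-- Provides the profile `V` required by the bounds on the walk. -/
theorem ae_siteLimit_eq (hα : 0 < e.alpha) :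
    ∀ᵐ ξ ∂e.siteLaw, ∀ x, siteLimit ξ x = failures (siteLimit ξ (x + 1)) (ξ x) := by
  refine ae_all_iff.2 fun x => ?_
  have h := (e.measurePreserving_site x).quasiMeasurePreserving.ae
    (e.ae_goodStacks.and (e.ae_backwardBounded_shift hα))
  filter_upwards [h] with ξ hξ
  have := backwardLimit_eq hξ.1 (hξ.2 0) (hξ.2 1)
  rw [seqShift_site] at this
  simpa [siteLimit] using this

/-- The event contains its preimage under the shift, so it is trivial by ergodicity, and the limit
law charges `0`. -/
theorem ae_exists_backwardLimit_shift_eq_zero (hα : 0 < e.alpha) :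
    ∀ᵐ s ∂e.stackLaw, ∃ i, backwardLimit (seqShift^[i] s) = 0 := by
  have hm : MeasurableSet {s | ∃ i, backwardLimit (seqShift^[i] s) = 0} := by
    simp only [Set.ofPred_exists]
    exact MeasurableSet.iUnion fun i =>
      (measurable_backwardLimit.comp (measurable_seqShift.iterate i)) (measurableSet_singleton 0)
  have hinv : (seqShift ⁻¹' {s | ∃ i, backwardLimit (seqShift^[i] s) = 0}) ≤ᵐ[e.stackLaw]
      {s | ∃ i, backwardLimit (seqShift^[i] s) = 0} :=
    Eventually.of_forall fun s ⟨i, hi⟩ => ⟨i + 1, hi⟩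
  rcases e.ergodic_stackLaw.ae_empty_or_univ_of_preimage_ae_le hm.nullMeasurableSet hinv with h | h
  · exfalso
    have h1 := e.limitLaw_singleton_pos hα 0
    rw [limitLaw_singleton] at h1
    refine h1.not_ge ?_
    rw [← measure_congr h |>.trans measure_empty]
    exact measure_mono fun s hs => ⟨0, hs⟩
  · exact eventuallyEq_univ.1 h

/-- Almost surely, some site to the left of the origin is never left to the left. -/
theorem ae_exists_siteLimit_eq_zero (hα : 0 < e.alpha) :
    ∀ᵐ ξ ∂e.siteLaw, ∃ x ≤ 0, siteLimit ξ x = 0 := by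
  have hm : ∀ n : ℕ, MeasurableSet {s | ∀ i ≤ n, backwardLimit (seqShift^[i] s) ≠ 0} := by
    intro n
    simp only [Set.ofPred_forall]
    exact MeasurableSet.iInter fun i => MeasurableSet.iInter fun _ =>
      ((measurable_backwardLimit.comp (measurable_seqShift.iterate i))
        (measurableSet_singleton 0)).compl
  have hlim : Tendsto (fun n : ℕ => e.stackLaw {s | ∀ i ≤ n, backwardLimit (seqShift^[i] s) ≠ 0})
      atTop (𝓝 (e.stackLaw ∅)) := by
    refine tendsto_measure_of_ae_tendsto_indicator_of_isFiniteMeasure _ MeasurableSet.empty hm ?_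
    filter_upwards [e.ae_exists_backwardLimit_shift_eq_zero hα] with s ⟨i, hi⟩
    filter_upwards [eventually_ge_atTop i] with n hn
    simp only [Set.mem_empty_iff_false, iff_false]
    exact fun h => h i hn hi
  rw [measure_empty] at hlim
  refine le_antisymm (ge_of_tendsto' hlim fun n => ?_) zero_le
  -- By stationarity the sites `-n, …, 0` may stand for the indices `0, …, n`, which turns a zero to
  -- the right into one to the left.
  rw [← (e.measurePreserving_site (-n)).measure_preimage (hm n).nullMeasurableSet]
  refine measure_mono fun ξ hξ i hi h0 => hξ ⟨-n + i, by omega, ?_⟩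
  rw [seqShift_iterate_site] at h0
  exact h0

theorem lintegral_limitLaw : ∫⁻ k, (k : ℝ≥0∞) ∂e.limitLaw =
    ∫⁻ s, (backwardLimit s : ℝ≥0∞) ∂e.stackLaw :=
  lintegral_map measurable_from_top measurable_backwardLimit

theorem lintegral_limitLaw_pos (hα : 0 < e.alpha) : 0 < ∫⁻ k, (k : ℝ≥0∞) ∂e.limitLaw := by
  rw [lintegral_countable']
  refine lt_of_lt_of_le ?_ (ENNReal.le_tsum 1)
  simpa using e.limitLaw_singleton_pos hα 1

/-- The average of the truncated backward compositions approximates the mean of the limit law. -/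
theorem exists_lt_lintegral_min_backward (hα : 0 < e.alpha) {a : ℝ≥0∞}
    (ha : a < ∫⁻ k, (k : ℝ≥0∞) ∂e.limitLaw) :
    ∃ k : ℕ, a < ∫⁻ s, (min (backward 0 k s) k : ℕ) ∂e.stackLaw := by
  have hlim : Tendsto (fun k : ℕ => ∫⁻ s, (min (backward 0 k s) k : ℕ) ∂e.stackLaw) atTop
      (𝓝 (∫⁻ s, (backwardLimit s : ℝ≥0∞) ∂e.stackLaw)) := by
    refine lintegral_tendsto_of_tendsto_of_monotone (fun k => ?_) ?_ ?_
    · exact ((measurable_from_top (f := fun w : ℕ => ((min w k : ℕ) : ℝ≥0∞))).comp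
        (measurable_backward 0 k)).aemeasurable
    · filter_upwards [e.ae_goodStacks] with s hs k l hkl
      exact Nat.cast_le.2 (min_le_min (backward_zero_monotone hs hkl) hkl)
    · filter_upwards [e.ae_goodStacks, e.ae_backwardBounded hα] with s hs hb
      refine tendsto_const_nhds.congr' ?_
      filter_upwards [hb.eventually_eq hs, eventually_ge_atTop (backwardLimit s)] with k hk hk'
      rw [hk, min_eq_left hk']
  rw [lintegral_limitLaw] at ha
  exact (hlim.eventually (lt_mem_nhds ha)).exists

/-- The compositions shorten near the end of the range, so the summands are not a Birkhoff sum. They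
dominate one of the fixed function `min (backward 0 k) k`, except for at most `k` terms. -/
theorem ae_exists_le_sum_backward (hα : 0 < e.alpha) {d : ℝ}
    (hd : ENNReal.ofReal d < ∫⁻ k, (k : ℝ≥0∞) ∂e.limitLaw) :
    ∀ᵐ s ∂e.stackLaw, ∃ K, 0 ≤ K ∧ ∀ m : ℕ, d * m - K ≤
      ∑ i ∈ Finset.range m, (backward 0 (m - i) (seqShift^[i] s) : ℝ) := by
  obtain ⟨k, hk⟩ := e.exists_lt_lintegral_min_backward hα hd
  set g : (ℕ → ℕ → Bool) → ℝ := fun s => (min (backward 0 k s) k : ℕ) with hg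
  have hgm : Measurable g :=
    (measurable_from_top (f := fun w : ℕ => ((min w k : ℕ) : ℝ))).comp (measurable_backward 0 k)
  have hgk : ∀ s, g s ≤ k := fun s => Nat.cast_le.2 (min_le_right _ _)
  have hg0 : ∀ s, 0 ≤ g s := fun s => Nat.cast_nonneg _
  have hgi : Integrable g e.stackLaw :=
    Integrable.of_bound hgm.aestronglyMeasurable k (Eventually.of_forall fun s => by
      rw [Real.norm_of_nonneg (hg0 s)]; exact hgk s)
  have hint : d < ∫ s, g s ∂e.stackLaw := by
    rw [integral_eq_lintegral_of_nonneg_ae (Eventually.of_forall hg0) hgm.aestronglyMeasurable]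
    simp only [hg, ENNReal.ofReal_natCast]
    rcases lt_or_ge d 0 with hneg | hpos
    · exact hneg.trans_le ENNReal.toReal_nonneg
    · refine (ENNReal.ofReal_lt_iff_lt_toReal hpos ?_).1 hk
      refine ne_top_of_le_ne_top (ENNReal.natCast_ne_top k) ?_
      calc _ ≤ ∫⁻ _, (k : ℝ≥0∞) ∂e.stackLaw :=
            lintegral_mono fun s => Nat.cast_le.2 (min_le_right _ _)
        _ = k := by simp
  filter_upwards [e.ergodic_stackLaw.ae_exists_le_birkhoffSum hgm hgi hint,
    (ae_all_iff.2 fun i => (e.ergodic_stackLaw.toMeasurePreserving.iterate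
      i).quasiMeasurePreserving.ae e.ae_goodStacks :
      ∀ᵐ s ∂e.stackLaw, ∀ i, GoodStacks (seqShift^[i] s))] with s ⟨K, hK⟩ hs
  -- The product `k * k` pays for the at most `k` last indices, where the truncated function is at
  -- most `k`.
  refine ⟨|K| + k * k, by positivity, fun m => ?_⟩
  have h1 := hK m
  have h2 : birkhoffSum seqShift g m s ≤
      ∑ i ∈ Finset.range m, (backward 0 (m - i) (seqShift^[i] s) : ℝ) + k * k := by
    have hterm : ∀ i ∈ Finset.range m, g (seqShift^[i] s) ≤
        (backward 0 (m - i) (seqShift^[i] s) : ℝ) + if m - k ≤ i then (k : ℝ) else 0 := by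
      intro i _
      by_cases hi : m - k ≤ i
      · rw [if_pos hi]
        have : (0 : ℝ) ≤ backward 0 (m - i) (seqShift^[i] s) := Nat.cast_nonneg _
        linarith [hgk (seqShift^[i] s)]
      · rw [if_neg hi, add_zero]
        exact Nat.cast_le.2 ((min_le_left _ _).trans
          (backward_zero_monotone (hs i) (show k ≤ m - i by omega)))
    refine (Finset.sum_le_sum hterm).trans ?_
    rw [Finset.sum_add_distrib, ← Finset.sum_filter, Finset.sum_const, nsmul_eq_mul]
    have hcard : ((Finset.range m).filter fun i => m - k ≤ i).card ≤ k := by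
      have : ((Finset.range m).filter fun i => m - k ≤ i) ⊆ Finset.Ico (m - k) m := by
        intro i hi
        simp only [Finset.mem_filter, Finset.mem_range] at hi
        exact Finset.mem_Ico.2 ⟨hi.2, hi.1⟩
      refine (Finset.card_le_card this).trans ?_
      rw [Nat.card_Ico]
      omega
    have : (((Finset.range m).filter fun i => m - k ≤ i).card : ℝ) ≤ k := Nat.cast_le.2 hcard
    gcongr
  linarith [le_abs_self K]

theorem ae_exists_sum_backwardLimit_le {d : ℝ}
    (hfin : ∫⁻ k, (k : ℝ≥0∞) ∂e.limitLaw ≠ ∞) (hd : (∫⁻ k, (k : ℝ≥0∞) ∂e.limitLaw).toReal < d) :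
    ∀ᵐ s ∂e.stackLaw, ∃ K, 0 ≤ K ∧ ∀ m : ℕ,
      ∑ i ∈ Finset.range m, (backwardLimit (seqShift^[i] s) : ℝ) ≤ d * m + K := by
  set g : (ℕ → ℕ → Bool) → ℝ := fun s => backwardLimit s with hg
  have hgm : Measurable g := (measurable_from_top (f := fun w : ℕ => (w : ℝ))).comp
    measurable_backwardLimit
  have hg0 : ∀ s, 0 ≤ g s := fun s => Nat.cast_nonneg _
  rw [lintegral_limitLaw] at hfin hd
  have hgi : Integrable g e.stackLaw := by
    refine ⟨hgm.aestronglyMeasurable, ?_⟩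
    rw [hasFiniteIntegral_iff_ofReal (Eventually.of_forall hg0)]
    simp only [hg, ENNReal.ofReal_natCast]
    exact hfin.lt_top
  have hint : ∫ s, g s ∂e.stackLaw < d := by
    rw [integral_eq_lintegral_of_nonneg_ae (Eventually.of_forall hg0) hgm.aestronglyMeasurable]
    simpa only [hg, ENNReal.ofReal_natCast] using hd
  filter_upwards [e.ergodic_stackLaw.ae_exists_birkhoffSum_le hgm hgi hint] with s ⟨K, hK⟩
  refine ⟨|K|, abs_nonneg K, fun m => ?_⟩
  have h1 := hK m
  simp only [birkhoffSum, hg] at h1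
  linarith [le_abs_self K]

theorem ae_site_exists_le_sum_backward (hα : 0 < e.alpha) {d : ℝ}
    (hd : ENNReal.ofReal d < ∫⁻ k, (k : ℝ≥0∞) ∂e.limitLaw) :
    ∀ᵐ ξ ∂e.siteLaw, ∃ K, 0 ≤ K ∧ ∀ m : ℕ, (1 + 2 * d) * m - K ≤
      m + 2 * ∑ i ∈ Finset.range m, (backward 0 (m - i) (fun k => ξ (i + k)) : ℝ) := by
  have h := (e.measurePreserving_site 0).quasiMeasurePreserving.ae
    (e.ae_exists_le_sum_backward hα hd)
  filter_upwards [h] with ξ ⟨K, hK0, hK⟩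
  refine ⟨2 * K, by positivity, fun m => ?_⟩
  have := hK m
  simp only [seqShift_iterate_site] at this
  simp only [zero_add] at this
  linarith

theorem ae_site_exists_sum_siteLimit_le {d : ℝ}
    (hfin : ∫⁻ k, (k : ℝ≥0∞) ∂e.limitLaw ≠ ∞) (hd : (∫⁻ k, (k : ℝ≥0∞) ∂e.limitLaw).toReal < d) :
    ∀ᵐ ξ ∂e.siteLaw, ∃ K, 0 ≤ K ∧ ∀ m : ℕ,
      ∑ i ∈ Finset.range m, (siteLimit ξ i : ℝ) ≤ d * m + K := by
  have h := (e.measurePreserving_site 0).quasiMeasurePreserving.ae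
    (e.ae_exists_sum_backwardLimit_le hfin hd)
  filter_upwards [h] with ξ ⟨K, hK0, hK⟩
  refine ⟨K, hK0, fun m => ?_⟩
  have := hK m
  simp only [seqShift_iterate_site] at this
  simp only [zero_add] at this
  exact this

theorem tendsto_upper_bound (c K : ℝ) :
    Tendsto (fun n : ℕ => ((n + K) / c) / n) atTop (𝓝 c⁻¹) := by
  have h : Tendsto (fun n : ℕ => (1 + K / n) / c) atTop (𝓝 ((1 + 0) / c)) :=
    ((tendsto_const_div_atTop_nhds_zero_nat K).const_add 1).div_const c
  rw [add_zero, one_div] at h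
  refine h.congr' ?_
  filter_upwards [eventually_gt_atTop 0] with n hn
  have : (n : ℝ) ≠ 0 := by positivity
  rw [div_right_comm, add_div (n : ℝ) K n, div_self this]

theorem tendsto_lower_bound (c d K C : ℝ) :
    Tendsto (fun n : ℕ => (n - 2 * (C + d * ((n + K) / c + 1) + K)) / n) atTop
      (𝓝 (1 - 2 * (d * c⁻¹))) := by
  have h : Tendsto (fun n : ℕ => 1 - 2 * (d * (((n + K) / c) / n) + (C + d + K) / n)) atTop
      (𝓝 (1 - 2 * (d * c⁻¹ + 0))) :=
    ((((tendsto_upper_bound c K).const_mul d).add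
      (tendsto_const_div_atTop_nhds_zero_nat (C + d + K))).const_mul 2).const_sub 1
  rw [add_zero] at h
  refine h.congr' ?_
  filter_upwards [eventually_gt_atTop 0] with n hn
  have : (n : ℝ) ≠ 0 := by positivity
  field_simp
  ring

/-- With an infinite mean every slope `1 + 2 j` is allowed in the lower bound on time, so the upper
speed is at most `1 / (1 + 2 j)` for all `j`; the barrier prevents a negative speed. -/
theorem ae_tendsto_walkPos_of_lintegral_eq_top (hα : 0 < e.alpha)
    (htop : ∫⁻ k, (k : ℝ≥0∞) ∂e.limitLaw = ∞) :
    ∀ᵐ ξ ∂e.siteLaw, Tendsto (fun n : ℕ => (walkPos ξ n : ℝ) / n) atTop (𝓝 0) := by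
  have hlow : ∀ᵐ ξ ∂e.siteLaw, ∀ j : ℕ, ∃ K, 0 ≤ K ∧ ∀ m : ℕ, (1 + 2 * (j : ℝ)) * m - K ≤
      m + 2 * ∑ i ∈ Finset.range m, (backward 0 (m - i) (fun k => ξ (i + k)) : ℝ) :=
    ae_all_iff.2 fun j => e.ae_site_exists_le_sum_backward hα (by rw [htop]; exact ENNReal.ofReal_lt_top)
  filter_upwards [hlow, e.ae_site_infinitelyManyHeads, e.ae_siteLimit_eq hα,
    e.ae_exists_siteLimit_eq_zero hα] with ξ hK hξ hV ⟨x, hx, hx0⟩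
  choose K hK0 hK using hK
  have hc : ∀ j : ℕ, (0 : ℝ) < 1 + 2 * j := fun j => by positivity
  refine tendsto_of_forall_le_of_forall_le (l := fun _ n => (x : ℝ) / n)
    (u := fun j n => ((n + K j) / (1 + 2 * j)) / n) (L := fun _ => 0)
    (U := fun j => (1 + 2 * (j : ℝ))⁻¹) (fun j n => ?_) (fun j n => ?_)
    (fun j => tendsto_const_div_atTop_nhds_zero_nat _) (fun j => tendsto_upper_bound _ _)
    tendsto_const_nhds ?_
  · have : (x : ℝ) ≤ walkPos ξ n := Int.cast_le.2 (le_walkPos hξ hV hx hx0 n)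
    gcongr
  · have := walkPos_le_of_forall_le hξ (hc j) (hK0 j) (hK j) n
    gcongr
  · exact tendsto_inv_atTop_zero.comp (tendsto_atTop_add_const_left _ _
      (tendsto_natCast_atTop_atTop.const_mul_atTop (by norm_num)))

theorem ae_tendsto_walkPos_of_lintegral_ne_top (hα : 0 < e.alpha)
    (hfin : ∫⁻ k, (k : ℝ≥0∞) ∂e.limitLaw ≠ ∞) :
    ∀ᵐ ξ ∂e.siteLaw, Tendsto (fun n : ℕ => (walkPos ξ n : ℝ) / n) atTop
      (𝓝 (1 + 2 * (∫⁻ k, (k : ℝ≥0∞) ∂e.limitLaw).toReal)⁻¹) := by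
  set a := (∫⁻ k, (k : ℝ≥0∞) ∂e.limitLaw).toReal with ha
  have ha0 : 0 < a := ENNReal.toReal_pos (e.lintegral_limitLaw_pos hα).ne' hfin
  -- The ergodic bounds need strict inequalities, so the mean `a` is approached from below by `d`,
  -- kept nonnegative by the shift `j + 2`, and from above by `d'`.
  set d : ℕ → ℝ := fun j => a - a / (j + 2) with hd
  set d' : ℕ → ℝ := fun j => a + 1 / (j + 1) with hd'
  have hd0 : ∀ j, 0 ≤ d j := by
    intro j
    have : a / ((j : ℝ) + 2) ≤ a := div_le_self ha0.le (by linarith [Nat.cast_nonneg (α := ℝ) j])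
    simp only [hd]; linarith
  have hd'0 : ∀ j, 0 ≤ d' j := fun j => by positivity
  have hda : ∀ j, d j < a := fun j => by
    have : 0 < a / ((j : ℝ) + 2) := by positivity
    simp only [hd]; linarith
  have hd'a : ∀ j, a < d' j := fun j => by
    have : 0 < 1 / ((j : ℝ) + 1) := by positivity
    simp only [hd']; linarith
  have hlow := ae_all_iff.2 fun j => e.ae_site_exists_le_sum_backward hα (d := d j)
    ((ENNReal.ofReal_lt_iff_lt_toReal (hd0 j) hfin).2 (hda j))
  have hupp := ae_all_iff.2 fun j => e.ae_site_exists_sum_siteLimit_le hfin (d := d' j) (hd'a j)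
  filter_upwards [hlow, hupp, e.ae_site_infinitelyManyHeads, e.ae_siteLimit_eq hα,
    e.ae_exists_siteLimit_eq_zero hα] with ξ hK hK' hξ hV ⟨x, hx, hx0⟩
  choose K hK0 hK using hK
  choose K' hK'0 hK' using hK'
  have hc : ∀ j : ℕ, (0 : ℝ) < 1 + 2 * d j := fun j => by linarith [hd0 j]
  have hdlim : Tendsto d atTop (𝓝 a) := by
    have h := (tendsto_const_div_atTop_nhds_zero_nat a).comp (tendsto_add_atTop_nat 2)
    have h2 := h.const_sub a
    rw [sub_zero] at h2
    refine h2.congr fun j => ?_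
    simp [hd]
  have hd'lim : Tendsto d' atTop (𝓝 a) := by
    have h2 := tendsto_one_div_add_atTop_nhds_zero_nat (𝕜 := ℝ) |>.const_add a
    rwa [add_zero] at h2
  have hclim : Tendsto (fun j => (1 + 2 * d j)⁻¹) atTop (𝓝 (1 + 2 * a)⁻¹) :=
    ((hdlim.const_mul 2).const_add 1).inv₀ (by positivity)
  set C : ℝ := ∑ y ∈ Finset.Ico x 0, (siteLimit ξ y : ℝ) with hC
  refine tendsto_of_forall_le_of_forall_le
    (l := fun j n => (n - 2 * (C + d' j * ((n + (K j + K' j)) / (1 + 2 * d j) + 1) +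
      (K j + K' j))) / n)
    (u := fun j n => ((n + K j) / (1 + 2 * d j)) / n)
    (fun j n => ?_) (fun j n => ?_)
    (fun j => tendsto_lower_bound _ _ _ _) (fun j => tendsto_upper_bound _ _) ?_ hclim
  · have := le_walkPos_of_forall_le hξ hV hx hx0 (hc j) (hd'0 j)
      (add_nonneg (hK0 j) (hK'0 j)) (fun m => by linarith [hK j m, hK'0 j])
      (fun m => by linarith [hK' j m, hK0 j]) n
    gcongr
  · have := walkPos_le_of_forall_le hξ (hc j) (hK0 j) (hK j) n
    gcongr
  -- The lower bounds tend to `1 - 2 a / (1 + 2 a)`, which equals `1 / (1 + 2 a)`.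
  · have h := ((hd'lim.mul hclim).const_mul 2).const_sub 1
    convert h using 2
    have : 1 + 2 * a ≠ 0 := by positivity
    field_simp
    ring

/-- The speed of the cookie random walk. -/
noncomputable def speed : ℝ := ((1 + 2 * ∫⁻ k, (k : ℝ≥0∞) ∂e.limitLaw)⁻¹).toReal

theorem ae_tendsto_walkPos (hα : 0 < e.alpha) :
    ∀ᵐ ξ ∂e.siteLaw, Tendsto (fun n : ℕ => (walkPos ξ n : ℝ) / n) atTop (𝓝 e.speed) := by
  by_cases h : ∫⁻ k, (k : ℝ≥0∞) ∂e.limitLaw = ∞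
  · have : e.speed = 0 := by simp [speed, h]
    rw [this]
    exact e.ae_tendsto_walkPos_of_lintegral_eq_top hα h
  · have : e.speed = (1 + 2 * (∫⁻ k, (k : ℝ≥0∞) ∂e.limitLaw).toReal)⁻¹ := by
      rw [speed, ENNReal.toReal_inv, ENNReal.toReal_add (by simp) (by finiteness),
        ENNReal.toReal_mul]
      simp
    rw [this]
    exact e.ae_tendsto_walkPos_of_lintegral_ne_top hα h

theorem speed_ne_zero_iff : e.speed ≠ 0 ↔ ∫⁻ k, (k : ℝ≥0∞) ∂e.limitLaw < ∞ := by
  rw [speed, ENNReal.toReal_ne_zero, lt_top_iff_ne_top, ENNReal.inv_ne_zero, ENNReal.inv_ne_top]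
  constructor
  · rintro ⟨h, -⟩ htop
    exact h (by simp [htop])
  · intro h
    exact ⟨by finiteness, by simp⟩

end CookieEnvironment

/-- In the transient regime there is a probability measure `π` on `ℕ` (the law of `Z_∞`) that is the
limit in law of the associated chain from every starting point and its unique invariant probability
measure. Every cookie random walk started at `0` has almost surely the same speed `v`, where
`v = 1 / (1 + 2 E[Z_∞])` with `1 / ∞ = 0`, and `v ≠ 0` if and only if `E[Z_∞] < ∞`. -/
theorem corollary2p3 {M : ℕ} (e : CookieEnvironment M) (hα : 0 < e.alpha) :
    ∃ (π : Measure ℕ) (_ : IsProbabilityMeasure π) (v : ℝ),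
      (∀ {Ω : Type*} [MeasurableSpace Ω] (μ : Measure Ω) [IsProbabilityMeasure μ]
        (z : ℕ) (Z : ℕ → Ω → ℕ), e.IsAssociatedChain z Z μ →
          TendstoInDistribution Z atTop id (fun _ => μ) π) ∧
      (∀ (ν : Measure ℕ) [IsProbabilityMeasure ν], e.IsInvariant ν ↔ ν = π) ∧
      (∀ {Ω : Type*} [MeasurableSpace Ω] (μ : Measure Ω) [IsProbabilityMeasure μ]
        (X : ℕ → Ω → ℤ), e.IsCookieWalk 0 X μ →
          ∀ᵐ ω ∂μ, Tendsto (fun n : ℕ => (X n ω : ℝ) / n) atTop (𝓝 v)) ∧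
      v = ((1 + 2 * ∫⁻ k, (k : ℝ≥0∞) ∂π)⁻¹).toReal ∧
      (v ≠ 0 ↔ ∫⁻ k, (k : ℝ≥0∞) ∂π < ∞) := by
  exact ⟨e.limitLaw, inferInstance, e.speed,
    fun μ _ z Z hZ => hZ.tendstoInDistribution hα,
    fun ν _ => e.isInvariant_iff hα ν,
    fun μ _ X hX => hX.ae_tendsto (e.ae_tendsto_walkPos hα),
    rfl, e.speed_ne_zero_iff⟩
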